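/- Let $\mathcal T$ be a finite tree with vertex set $\mathcal V$, each vertex $v$ carrying an integer Euler number $e_v$ (all genera are zero). Let $L=\mathbb Z\langle E_v\rangle_{v\in\mathcal V}$ with the symmetric bilinear form $(E_v,E_v)=e_v$, and for $v\ne w$, $(E_v,E_w)=1$ if $v,w$ are adjacent and $0$ otherwise; assume that this form is negative definite. Let $L'=\{l'\in L\otimes\mathbb Q : (l',L)\subset\mathbb Z\}$, with $\mathbb Z$-basis $\{E_v^*\}_v$ defined by $(E_v^*,E_w)=-\delta_{vw}$, and write $[x]$ for the class of $x\in L'$ in $H=L'/L$. For $l'=\sum_v l'_vE_v\in L'$ put $\mathbf t^{l'}=\prod_v t_v^{l'_v}$ and write $x\ge y$ if $x_v\ge y_v$ for all $v$. Denote by $\delta_v$ the valency of $v$, and let $Z(\mathbf t)=\sum_{l'\in L'}z^{\mathcal T}(l')\,\mathbf t^{l'}$ be the Taylor expansion at the origin of $\prod_{v\in\mathcal V}(1-\mathbf t^{E_v^*})^{\delta_v-2}$. For $h\in H$, a non-empty $\mathcal I\subset\mathcal V$ and $x\in L'$ with $[x]=h$ define the (finite) sums $$Q^{\mathcal T}_h(x)=\sum_{l'\not\ge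 x,\ [l']=h}z^{\mathcal T}(l'),\qquad Q^{\mathcal T}_{h,\mathcal I}(x)=\sum_{l'|_{\mathcal I}\not\ge x|_{\mathcal I},\ [l']=h}z^{\mathcal T}(l'),$$ where $l'|_{\mathcal I}$ is the tuple of the $E_v$-coordinates of $l'$ with $v\in\mathcal I$. Fix a non-empty $\mathcal I\subset\mathcal V$, let $\mathcal T_i$ be the connected components of the full subgraph $\mathcal T\setminus\mathcal I$ (with the same Euler numbers), and let $j_i^*:L'(\mathcal T)\to L'(\mathcal T_i)$ be the homomorphism with $j_i^*(E_v^*(\mathcal T))=E_v^*(\mathcal T_i)$ if $v$ is a vertex of $\mathcal T_i$, and $j_i^*(E_v^*(\mathcal T))=0$ otherwise. Theorem. There is an integer $N$, depending only on $\mathcal T$ and $\mathcal I$, such that for every $l'_0=\sum_v a_vE_v^*\in L'$ with integers $a_v\ge N$ for all $v\in\mathcal V$, $$Q^{\mathcal T}_{[l'_0]}(l'_0)=Q^{\mathcal T}_{[l'_0],\mathcal I}(l'_0)+\sum_i Q^{\mathcal T_i}_{[j_i^*(l'_0)]}(j_i^*(l'_0)).$$ -/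

import Mathlib

open scoped Classical

noncomputable section

/-- A plumbing graph on the vertex set `V` with all genus decorations zero: a simple graph
together with an Euler number (self-intersection) at each vertex. -/
structure PlumbingGraph (V : Type*) where
  graph : SimpleGraph V
  euler : V → ℤ

namespace PlumbingGraph

variable {V : Type*} [Fintype V] (T : PlumbingGraph V)

/-- The intersection matrix `(E_v, E_w)`. -/
def intMatrix : Matrix V V ℚ :=
  Matrix.of fun v w => if v = w then (T.euler v : ℚ) else if T.graph.Adj v w then 1 else 0

/-- The intersection form on `L ⊗ ℚ`, where `L ⊗ ℚ` is `V → ℚ` through the basis `E_v`. -/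
def form : LinearMap.BilinForm ℚ (V → ℚ) := Matrix.toBilin' T.intMatrix

end PlumbingGraph

/-- A negative definite plumbing tree of spheres (so that the plumbed 3-manifold is a rational
homology sphere). `SimpleGraph.IsTree` means connected (in particular non-empty) and acyclic. -/
structure PlumbingTree (V : Type*) [Fintype V] extends PlumbingGraph V where
  isTree : graph.IsTree
  negDef : ∀ x : V → ℚ, x ≠ 0 → toPlumbingGraph.form x x < 0

namespace PlumbingTree

variable {V : Type*} [Fintype V] (T : PlumbingTree V)

/-- The lattice `L = ℤ⟨E_v⟩` inside `L ⊗ ℚ = (V → ℚ)`. -/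
def lattice (V : Type*) : Submodule ℤ (V → ℚ) where
  carrier := {x | ∀ v, ∃ n : ℤ, x v = n}
  zero_mem' := fun _ => ⟨0, by simp⟩
  add_mem' := by
    intro x y hx hy v
    obtain ⟨m, hm⟩ := hx v
    obtain ⟨n, hn⟩ := hy v
    exact ⟨m + n, by simp [hm, hn]⟩
  smul_mem' := by
    intro c x hx v
    obtain ⟨m, hm⟩ := hx v
    exact ⟨c * m, by simp [hm]⟩

/-- The dual lattice `L' = {l' ∈ L ⊗ ℚ : (l', L) ⊆ ℤ}`. -/
def dualLattice : Submodule ℤ (V → ℚ) where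
  carrier := {x | ∀ l ∈ lattice V, ∃ n : ℤ, T.form x l = n}
  zero_mem' := fun _ _ => ⟨0, by simp⟩
  add_mem' := by
    intro x y hx hy l hl
    obtain ⟨m, hm⟩ := hx l hl
    obtain ⟨n, hn⟩ := hy l hl
    exact ⟨m + n, by simp [hm, hn]⟩
  smul_mem' := by
    intro c x hx l hl
    obtain ⟨m, hm⟩ := hx l hl
    refine ⟨c * m, ?_⟩
    rw [map_zsmul, LinearMap.smul_apply, hm]
    simp

/-- The group `H = L' / L`; the class of `x : L'` is `Submodule.Quotient.mk x`. (Note `L ⊆ L'`.) -/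
abbrev H : Type _ := T.dualLattice ⧸ (lattice V).comap T.dualLattice.subtype

/-- The class `[x] ∈ H` of `x ∈ L'`. -/
def cls (x : T.dualLattice) : T.H := Submodule.Quotient.mk x

theorem form_apply (x y : V → ℚ) :
    T.form x y = ∑ v, ∑ w, x v * T.intMatrix v w * y w := by
  simp [PlumbingGraph.form, Matrix.toBilin'_apply]

theorem intMatrix_symm (v w : V) : T.intMatrix v w = T.intMatrix w v := by
  simp only [PlumbingGraph.intMatrix, Matrix.of_apply]
  by_cases h : v = w
  · subst h; rfl
  · simp [h, Ne.symm h, T.graph.adj_comm]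

theorem intMatrix_int (v w : V) : ∃ n : ℤ, T.intMatrix v w = n := by
  simp only [PlumbingGraph.intMatrix, Matrix.of_apply]
  split_ifs
  exacts [⟨_, rfl⟩, ⟨1, by simp⟩, ⟨0, by simp⟩]

theorem form_single (x : V → ℚ) (w : V) :
    T.form x (Pi.single w 1) = (T.intMatrix.mulVec x) w := by
  simp [form_apply, Matrix.mulVec, dotProduct, Pi.single_apply, T.intMatrix_symm w, mul_comm]

theorem isUnit_det : IsUnit T.intMatrix.det := by
  rw [isUnit_iff_ne_zero]
  intro h
  obtain ⟨x, hx, hx0⟩ := Matrix.exists_mulVec_eq_zero_iff.2 h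
  have h1 := T.negDef x hx
  have h2 : T.form x x = 0 := by
    have : T.form x x = x ⬝ᵥ T.intMatrix.mulVec x := by
      simp [form_apply, Matrix.mulVec, dotProduct, Finset.mul_sum, mul_assoc]
    rw [this, hx0]; simp
  exact absurd h1 (by rw [h2]; exact lt_irrefl _)

theorem mem_dualLattice_iff (x : V → ℚ) :
    x ∈ T.dualLattice ↔ ∀ w, ∃ n : ℤ, (T.intMatrix.mulVec x) w = n := by
  constructor
  · intro hx w
    rw [← form_single]
    refine hx _ fun v => ?_
    by_cases h : v = w
    · exact ⟨1, by simp [h]⟩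
    · exact ⟨0, by simp [h]⟩
  · intro hx l hl
    choose n hn using hx
    choose m hm using hl
    refine ⟨∑ w, n w * m w, ?_⟩
    push_cast
    rw [form_apply, Finset.sum_comm]
    refine Finset.sum_congr rfl fun w _ => ?_
    rw [← hn, ← hm, Matrix.mulVec, dotProduct, Finset.sum_mul]
    refine Finset.sum_congr rfl fun v _ => ?_
    rw [T.intMatrix_symm w v]; ring

/-- The anti-dual vector `E_v^*` as an element of `L ⊗ ℚ`: minus the `v`-th column of the inverse
of the intersection matrix, see `form_EstarVec`. -/
def EstarVec (v : V) : V → ℚ := fun w => -(T.intMatrix⁻¹ w v)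

theorem mulVec_EstarVec (v : V) : T.intMatrix.mulVec (T.EstarVec v) = -Pi.single v 1 := by
  have h : T.EstarVec v = -(T.intMatrix⁻¹.mulVec (Pi.single v 1)) := by
    ext w; simp [EstarVec]
  rw [h, Matrix.mulVec_neg, Matrix.mulVec_mulVec, Matrix.mul_nonsing_inv _ T.isUnit_det,
    Matrix.one_mulVec]

/-- The defining property `(E_v^*, E_w) = -δ_{vw}`. -/
theorem form_EstarVec (v w : V) :
    T.form (T.EstarVec v) (Pi.single w 1) = if v = w then -1 else 0 := by
  rw [form_single, mulVec_EstarVec]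
  by_cases h : v = w
  · simp [h]
  · simp [h, Ne.symm h]

/-- `E_v^*` as an element of `L'`. -/
def Estar (v : V) : T.dualLattice :=
  ⟨T.EstarVec v, by
    rw [mem_dualLattice_iff]
    intro w
    rw [mulVec_EstarVec]
    by_cases h : w = v
    · exact ⟨-1, by simp [h]⟩
    · exact ⟨0, by simp [h]⟩⟩

theorem linearIndependent_Estar : LinearIndependent ℤ T.Estar := by
  rw [Fintype.linearIndependent_iff]
  intro g hg w
  have h1 : T.form (∑ v, g v • T.EstarVec v) (Pi.single w 1) = 0 := by
    have : (∑ v, g v • T.EstarVec v) = ((∑ v, g v • T.Estar v : T.dualLattice) : V → ℚ) := by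
      simp [Estar]
    rw [this, hg]; simp
  rw [map_sum, LinearMap.sum_apply] at h1
  simp only [map_zsmul, LinearMap.smul_apply, form_EstarVec] at h1
  simpa using h1

theorem span_Estar : ⊤ ≤ Submodule.span ℤ (Set.range T.Estar) := by
  intro x _
  choose n hn using (T.mem_dualLattice_iff x).1 x.2
  have hx : x = ∑ v, (-n v) • T.Estar v := by
    have key : T.intMatrix.mulVec (x : V → ℚ)
        = T.intMatrix.mulVec (∑ v, (-n v) • T.EstarVec v) := by
      rw [Matrix.mulVec_sum]
      ext w
      simp only [neg_smul, Matrix.mulVec_neg, Finset.sum_apply, Pi.neg_apply]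
      have : ∀ v, T.intMatrix.mulVec (n v • T.EstarVec v) = -(n v • Pi.single v (1 : ℚ)) := by
        intro v
        rw [← smul_neg, ← mulVec_EstarVec, Matrix.mulVec_smul]
      simp only [this, hn]
      simp [Pi.single_apply]
    have := congrArg (T.intMatrix⁻¹.mulVec) key
    rw [Matrix.mulVec_mulVec, Matrix.mulVec_mulVec, Matrix.nonsing_inv_mul _ T.isUnit_det,
      Matrix.one_mulVec, Matrix.one_mulVec] at this
    apply Subtype.ext
    simpa [Estar] using this
  rw [hx]
  exact Submodule.sum_mem _ fun v _ =>
    Submodule.smul_mem _ _ (Submodule.subset_span ⟨v, rfl⟩)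

/-- The `ℤ`-basis `E_v^*` of `L'`. -/
def EstarBasis : Module.Basis V ℤ T.dualLattice :=
  Module.Basis.mk T.linearIndependent_Estar T.span_Estar

/-- `1 - x_v` as an invertible power series over `ℤ`. -/
def oneSubX (v : V) : (MvPowerSeries V ℤ)ˣ where
  val := 1 - MvPowerSeries.X v
  inv := MvPowerSeries.invOfUnit (1 - MvPowerSeries.X v) 1
  val_inv := MvPowerSeries.mul_invOfUnit _ _ (by simp)
  inv_val := MvPowerSeries.invOfUnit_mul _ _ (by simp)

/-- The Taylor expansion at the origin of `∏_v (1 - x_v)^(δ_v - 2)`, where `δ_v` is the valency. -/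
def Zx : MvPowerSeries V ℤ :=
  ((∏ v, oneSubX v ^ ((T.graph.degree v : ℤ) - 2) : (MvPowerSeries V ℤ)ˣ) : MvPowerSeries V ℤ)

/-- The coefficient `z(l')` of `t^{l'}` in the topological Poincaré series `Z(t)`, the Taylor
expansion of `∏_v (1 - t^{E_v^*})^(δ_v - 2)`. That is, `x_v = t^{E_v^*}` is substituted in `Zx`:
the monomial `∏_v x_v^{b_v}` becomes `t^{∑_v b_v E_v^*}`. (At most one `b` contributes.) -/
def z (l' : T.dualLattice) : ℤ :=
  ∑ᶠ (b : V →₀ ℕ) (_ : ∑ v, b v • T.Estar v = l'), MvPowerSeries.coeff b T.Zx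

/-- The counting function `Q_h(x) = ∑ z(l')` over `l' ∈ L'` with `[l'] = h` and `l' ≱ x`
(coordinatewise order in the basis `E_v`). Only finitely many terms are non-zero. -/
def Q (h : T.H) (x : T.dualLattice) : ℤ :=
  ∑ᶠ (l' : T.dualLattice) (_ : T.cls l' = h ∧ ¬ ∀ v, x.1 v ≤ l'.1 v), T.z l'

/-- The counting function `Q_{h,I}(x) = ∑ z(l')` over `l' ∈ L'` with `[l'] = h` and
`l'|_I ≱ x|_I`, of the series reduced to the variables in `I`. -/
def QI (h : T.H) (I : Set V) (x : T.dualLattice) : ℤ :=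
  ∑ᶠ (l' : T.dualLattice) (_ : T.cls l' = h ∧ ¬ ∀ v ∈ I, x.1 v ≤ l'.1 v), T.z l'

/-- The full plumbing subgraph on a set `S` of vertices that induces a connected subgraph. -/
def restrict (S : Set V) (hS : (T.graph.induce S).Connected) : PlumbingTree S where
  graph := T.graph.induce S
  euler := fun v => T.euler v
  isTree := ⟨hS, T.isTree.isAcyclic.induce S⟩
  negDef := by
    intro x hx
    have h0 : (fun v => if h : v ∈ S then x ⟨v, h⟩ else 0 : V → ℚ) ≠ 0 := by
      intro h
      apply hx
      ext v
      simpa using congrFun h v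
    have h1 := T.negDef _ h0
    have hsum : ∀ f : V → ℚ, (∀ v ∉ S, f v = 0) → ∑ v : S, f v = ∑ v, f v := by
      intro f hf
      rw [← Finset.sum_subset (Finset.subset_univ S.toFinset)
        (fun v _ hv => hf v (by simpa using hv))]
      exact (Finset.sum_subtype S.toFinset (by simp) f).symm
    convert h1 using 1
    rw [T.form_apply, ← hsum _ (fun v hv => by simp [hv])]
    simp only [PlumbingGraph.form, Matrix.toBilin'_apply]
    refine Finset.sum_congr rfl fun v _ => ?_
    rw [← hsum _ (fun w hw => by simp [hw])]
    refine Finset.sum_congr rfl fun w _ => ?_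
    simp [PlumbingGraph.intMatrix, Subtype.ext_iff]

/-- The dual operator `j^* : L'(T) → L'(T_S)` of the inclusion of the full subgraph on `S`:
`E_v^* ↦ E_v^*` for `v ∈ S` and `E_v^* ↦ 0` otherwise. -/
def jstar (S : Set V) (hS : (T.graph.induce S).Connected) :
    T.dualLattice →ₗ[ℤ] (T.restrict S hS).dualLattice :=
  T.EstarBasis.constr ℤ fun v => if h : v ∈ S then (T.restrict S hS).Estar ⟨v, h⟩ else 0

/-- The connected components of `T ∖ I`. -/
abbrev Comp (I : Set V) : Type _ := (T.graph.induce Iᶜ).ConnectedComponent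

/-- The set of vertices of `T` that lie in a connected component of `T ∖ I`. -/
def compVerts (I : Set V) (c : T.Comp I) : Set V := Subtype.val '' c.supp

theorem compVerts_connected (I : Set V) (c : T.Comp I) :
    (T.graph.induce (T.compVerts I c)).Connected := by
  have h : ((T.graph.induce Iᶜ).induce c.supp).Connected := c.maximal_connected_induce_supp.1
  let f : ((T.graph.induce Iᶜ).induce c.supp) →g T.graph.induce (T.compVerts I c) :=
    { toFun := fun v => ⟨v.1.1, v.1, v.2, rfl⟩
      map_rel' := fun {_ _} h => h }
  refine h.map f ?_
  rintro ⟨_, v, hv, rfl⟩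
  exact ⟨⟨v, hv⟩, rfl⟩

/-- The component `T_i` of `T ∖ I`, as a plumbing tree. -/
def component (I : Set V) (c : T.Comp I) : PlumbingTree (T.compVerts I c) :=
  T.restrict _ (T.compVerts_connected I c)

/-- The operator `j_i^* : L'(T) → L'(T_i)` for a component `T_i` of `T ∖ I`. -/
def jstarComp (I : Set V) (c : T.Comp I) :
    T.dualLattice →ₗ[ℤ] (T.component I c).dualLattice :=
  T.jstar _ (T.compVerts_connected I c)

end PlumbingTree

end

/-! Write $l'=l'_0+\sum_v n_vE_v$. Pairing with $E_v$ shows that the $E_v^*$-coordinate of $l'$ is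
$a_v-e_vn_v-\sum_{y\sim v}n_y$, so $z(l')$ is a product of local weights: at $v$ stands the
$\delta_v$-th difference in $j$ of $\psi_v(s,j)=\max(1-j+a_v-e_vs,0)$, taken at $s=n_v$ and
$j=\sum_{y\sim v}n_y$ (`z_add_latticeVec`). Now $Q$ sums these weights over the $n$ that are
negative somewhere, and $Q_{\mathcal I}$ over those negative somewhere on $\mathcal I$.

The remaining $n$ are non-negative on $\mathcal I$ and negative elsewhere. Sort them by their first
negative vertex $w$ in a fixed order of $\mathcal V$ (`negSum_univ_eq`). The same sorting applies to
the component containing $w$, so it suffices to prove, for each $w$, that the sum over $\mathcal T$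
with $n_w<0$ and $n\ge 0$ on $\mathcal I$ and before $w$ equals the analogous sum over that
component (`stateSum_eq_of_subset`).

Root the tree at $w$ and sum over one leaf after another. Summation by parts along a leaf $u$
attached to $v$ uses up one of the differences at $v$ and replaces $\psi_v(s,\cdot)$ by its
convolution with the kernel $k\mapsto D\psi_u(k)(s)-D\psi_u(k-1)(s)$, where $D$ is `diffOp`; this is
`collapse`. Since $D\psi_u(k)(s)=1$ when $k\ge 0\ge s$, the new weight at $s\le 0$ involves only the
old weights at non-positive arguments. If moreover $n_u\ge 0$ is imposed, the kernel at $s\le 0$ is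
the unit mass at $0$ and nothing changes. As $n_w<0$, only these values count in the end, and all
branches entering through $\mathcal I$ can be cut off.

Two invariants survive each step. The weights live below lines of positive slope $\beta_v$,
initially $-e_v$ and transformed by Gaussian elimination, $\beta_v\mapsto\beta_v-1/\beta_u$;
positivity comes from negative definiteness and makes every sum finite. Also, for $s\ge 0$,
$D\psi_v(s)=1$ up to a margin above that line. Each collapse costs one unit of margin, so the number
of neighbours suffices, and this is supplied by $a_v\ge|\mathcal V|$. -/

namespace PlumbingTree

open Function

/-! ### Differences and summation by parts on the integers -/

/-- The backward difference operator `φ ↦ φ(j) - φ(j + 1)`. -/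
def diffOp (φ : ℤ → ℤ) : ℤ → ℤ := fun j => φ j - φ (j + 1)

theorem finite_support_of_bounds {f : ℤ → ℤ} (a b : ℤ) (h : ∀ k, f k ≠ 0 → a ≤ k ∧ k ≤ b) :
    (support f).Finite :=
  (Set.finite_Icc a b).subset fun k hk => h k hk

/-- Summation by parts. One factor vanishes far to the left and the other far to the right, so all
sums are finite and there are no boundary terms. -/
theorem finsum_mul_diffOp {g φ : ℤ → ℤ} {a b : ℤ} (hg : ∀ k < a, g k = 0)
    (hφ : ∀ k, b < k → φ k = 0) :
    ∑ᶠ k, g k * diffOp φ k = ∑ᶠ k, (g k - g (k - 1)) * φ k := by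
  have h1 : (support fun k => g k * φ k).Finite := by
    refine finite_support_of_bounds a b fun k hk => ⟨?_, ?_⟩ <;> by_contra! h
    · exact hk (by simp [hg k h])
    · exact hk (by simp [hφ k h])
  have h2 : (support fun k => g k * φ (k + 1)).Finite := by
    refine finite_support_of_bounds a b fun k hk => ⟨?_, ?_⟩ <;> by_contra! h
    · exact hk (by simp [hg k h])
    · exact hk (by simp [hφ (k + 1) (by omega)])
  have h3 : (support fun k => g (k - 1) * φ k).Finite := by
    refine finite_support_of_bounds a (b + 1) fun k hk => ⟨?_, ?_⟩ <;> by_contra! h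
    · exact hk (by simp [hg (k - 1) (by omega)])
    · exact hk (by simp [hφ k (by omega)])
  have h4 : ∑ᶠ k, g k * φ (k + 1) = ∑ᶠ k, g (k - 1) * φ k := by
    rw [← finsum_comp_equiv (Equiv.addRight (1 : ℤ)) (f := fun k => g (k - 1) * φ k)]
    simp
  calc ∑ᶠ k, g k * diffOp φ k = ∑ᶠ k, (g k * φ k - g k * φ (k + 1)) := by
        simp only [diffOp, mul_sub]
    _ = ∑ᶠ k, (g k * φ k - g (k - 1) * φ k) := by
        rw [finsum_sub_distrib h1 h2, finsum_sub_distrib h1 h3, h4]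
    _ = _ := by simp only [sub_mul]

theorem finsum_diff_eq_one {g : ℤ → ℤ} {a b : ℤ} (hg : ∀ k < a, g k = 0)
    (hg' : ∀ k, b ≤ k → g k = 1) : ∑ᶠ k, (g k - g (k - 1)) = 1 := by
  have key : ∀ n : ℕ, ∑ k ∈ Finset.Icc a (a + n), (g k - g (k - 1)) = g (a + n) := by
    intro n
    induction n with
    | zero => simp [hg (a - 1) (by omega)]
    | succ n ih =>
      have : Finset.Icc a (a + (n + 1 : ℕ)) = insert (a + (n + 1 : ℕ)) (Finset.Icc a (a + n)) := by
        ext x; simp only [Finset.mem_Icc, Finset.mem_insert]; push_cast; omega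
      rw [this, Finset.sum_insert (by simp), ih]
      have : a + ((n + 1 : ℕ) : ℤ) - 1 = a + n := by push_cast; ring
      rw [this]; ring
  rw [finsum_eq_sum_of_support_subset (s := Finset.Icc a (a + (b - a + 1).toNat)), key]
  · exact hg' _ (by omega)
  · intro k hk
    simp only [Finset.coe_Icc, Set.mem_Icc]
    by_contra h
    apply hk
    rcases lt_or_ge k a with h1 | h1
    · simp [hg k h1, hg (k - 1) (by omega)]
    · simp [hg' k (by omega), hg' (k - 1) (by omega)]

theorem diffOp_iterate_eq_zero {φ : ℤ → ℤ} {b : ℤ} (h : ∀ k, b < k → φ k = 0) (d : ℕ) :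
    ∀ k, b < k → diffOp^[d] φ k = 0 := by
  induction d with
  | zero => simpa using h
  | succ d ih =>
    intro k hk
    rw [iterate_succ_apply', diffOp, ih k hk, ih (k + 1) (by omega), sub_zero]

theorem diffOp_iterate_finsum {c φ : ℤ → ℤ} (hc : (support c).Finite) (d : ℕ) :
    ∀ j, diffOp^[d] (fun j => ∑ᶠ k, c k * φ (j + k)) j
      = ∑ᶠ k, c k * diffOp^[d] φ (j + k) := by
  induction d with
  | zero => simp
  | succ d ih =>
    intro j
    have hfin : ∀ f : ℤ → ℤ, (support fun k => c k * f k).Finite := fun f =>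
      hc.subset fun k hk => left_ne_zero_of_mul hk
    rw [iterate_succ_apply', diffOp, ih, ih, ← finsum_sub_distrib (hfin _) (hfin _)]
    refine finsum_congr fun k => ?_
    rw [iterate_succ_apply', diffOp, mul_sub]
    rw [add_right_comm]

/-! ### Absorbing a leaf into its neighbour -/

/-- The generalized vertex weight obtained at a vertex with weight `χ` after summing over an
adjacent leaf with weight `ψ`. -/
noncomputable def collapse (ψ χ : ℤ → ℤ → ℤ) : ℤ → ℤ → ℤ := fun s j =>
  ∑ᶠ k, (diffOp (ψ k) s - diffOp (ψ (k - 1)) s) * χ s (j + k)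

/-- The weight `ψ` is supported below the line of slope `β`, up to a constant. -/
def SupportedBelow (ψ : ℤ → ℤ → ℤ) (β : ℚ) : Prop :=
  ∃ K : ℚ, ∀ s j : ℤ, ψ s j ≠ 0 → (j : ℚ) ≤ β * s + K

/-- For `s ≥ 0` the difference of `ψ s` is constant equal to `1` below the line of slope `β`. -/
def StableBelow (ψ : ℤ → ℤ → ℤ) (β : ℚ) (d : ℕ) : Prop :=
  ∀ s j : ℤ, 0 ≤ s → (j : ℚ) ≤ β * s + d → diffOp (ψ s) j = 1

theorem SupportedBelow.exists_bound {ψ : ℤ → ℤ → ℤ} {β : ℚ} (h : SupportedBelow ψ β) (s : ℤ) :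
    ∃ b : ℤ, ∀ j, b < j → ψ s j = 0 := by
  obtain ⟨K, hK⟩ := h
  refine ⟨⌊β * s + K⌋, fun j hj => ?_⟩
  by_contra hne
  exact absurd (hK s j hne) (not_le.2 (Int.floor_lt.1 hj))

theorem SupportedBelow.le_of_diffOp_iterate {ψ : ℤ → ℤ → ℤ} {β K : ℚ}
    (hK : ∀ s j : ℤ, ψ s j ≠ 0 → (j : ℚ) ≤ β * s + K) (d : ℕ) (s j : ℤ)
    (h : diffOp^[d] (ψ s) j ≠ 0) : (j : ℚ) ≤ β * s + K := by
  by_contra! hlt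
  refine h (diffOp_iterate_eq_zero (b := ⌊β * s + K⌋) (fun k hk => ?_) d j (Int.floor_lt.2 hlt))
  by_contra hne
  exact absurd (hK s k hne) (not_le.2 (Int.floor_lt.1 hk))

theorem SupportedBelow.exists_lower {ψ : ℤ → ℤ → ℤ} {β : ℚ} (h : SupportedBelow ψ β) (hβ : 0 < β)
    (s : ℤ) : ∃ a : ℤ, ∀ k < a, diffOp (ψ k) s = 0 := by
  obtain ⟨K, hK⟩ := h
  refine ⟨⌈(s - K) / β⌉, fun k hk => ?_⟩
  by_contra hne
  have h1 := SupportedBelow.le_of_diffOp_iterate hK 1 k s hne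
  have h2 := Int.lt_ceil.1 hk
  rw [lt_div_iff₀ hβ] at h2
  linarith

theorem StableBelow.exists_upper {ψ : ℤ → ℤ → ℤ} {β : ℚ} {d : ℕ} (h : StableBelow ψ β d)
    (hβ : 0 < β) (s : ℤ) : ∃ b : ℤ, ∀ k, b ≤ k → diffOp (ψ k) s = 1 := by
  refine ⟨max 0 ⌈s / β⌉, fun k hk => h k s (le_trans (le_max_left _ _) hk) ?_⟩
  have h1 := Int.ceil_le.1 ((le_max_right _ _).trans hk)
  rw [div_le_iff₀ hβ] at h1
  have : (0 : ℚ) ≤ d := by positivity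
  linarith

variable {ψ χ : ℤ → ℤ → ℤ} {β γ : ℚ} {d : ℕ}

/-- The kernel is the increment of $k\mapsto D\psi(k)(s)$, which is $0$ for very negative $k$ by the
support bound and $1$ for large $k$ by stability. Telescoping then gives it total mass one. -/
theorem finite_support_kernel (hψ : SupportedBelow ψ β) (hψ' : StableBelow ψ β d) (hβ : 0 < β)
    (s : ℤ) : (support fun k => diffOp (ψ k) s - diffOp (ψ (k - 1)) s).Finite := by
  obtain ⟨a, ha⟩ := hψ.exists_lower hβ s
  obtain ⟨b, hb⟩ := hψ'.exists_upper hβ s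
  refine finite_support_of_bounds a b fun k hk => ⟨?_, ?_⟩ <;> by_contra! h
  · exact hk (by simp [ha k h, ha (k - 1) (by omega)])
  · exact hk (by simp [hb k h.le, hb (k - 1) (by omega)])

theorem finsum_kernel (hψ : SupportedBelow ψ β) (hψ' : StableBelow ψ β d) (hβ : 0 < β)
    (s : ℤ) : ∑ᶠ k, (diffOp (ψ k) s - diffOp (ψ (k - 1)) s) = 1 := by
  obtain ⟨a, ha⟩ := hψ.exists_lower hβ s
  obtain ⟨b, hb⟩ := hψ'.exists_upper hβ s
  exact finsum_diff_eq_one (g := fun k => diffOp (ψ k) s) ha hb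

/-- Summation over the leaf variable. -/
theorem finsum_leaf (hψ : SupportedBelow ψ β) (hψ' : StableBelow ψ β d) (hβ : 0 < β)
    (hχ : SupportedBelow χ γ) (m : ℕ) (s j : ℤ) :
    ∑ᶠ k, diffOp (ψ k) s * diffOp^[m + 1] (χ s) (j + k)
      = diffOp^[m] (collapse ψ χ s) j := by
  obtain ⟨a, ha⟩ := hψ.exists_lower hβ s
  obtain ⟨b, hb⟩ := hχ.exists_bound s
  have hb' := diffOp_iterate_eq_zero hb m
  have := diffOp_iterate_finsum (φ := χ s) (finite_support_kernel hψ hψ' hβ s) m j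
  -- Differences in $j$ commute with the convolution; then one of the $m+1$ differences on $\chi$ is
  -- moved by parts onto the leaf factor.
  rw [show collapse ψ χ s = fun j => ∑ᶠ k, (diffOp (ψ k) s - diffOp (ψ (k - 1)) s) * χ s (j + k)
    from rfl, this, ← finsum_mul_diffOp (g := fun k => diffOp (ψ k) s)
      (φ := fun k => diffOp^[m] (χ s) (j + k)) (b := b - j) ha (fun k hk => hb' _ (by omega))]
  refine finsum_congr fun k => ?_
  rw [iterate_succ_apply']
  simp [diffOp, add_assoc]

/-- A non-zero term needs $s\le\beta k+K$ and $j+k\le\gamma s+K'$; eliminating $k$ gives the new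
line. -/
theorem SupportedBelow.collapse (hψ : SupportedBelow ψ β) (hβ : 0 < β)
    (hχ : SupportedBelow χ γ) : SupportedBelow (collapse ψ χ) (γ - 1 / β) := by
  obtain ⟨K, hK⟩ := hψ
  obtain ⟨K', hK'⟩ := hχ
  refine ⟨K' + K / β, fun s j hne => ?_⟩
  obtain ⟨k, hk⟩ : ∃ k, (diffOp (ψ k) s - diffOp (ψ (k - 1)) s) * χ s (j + k) ≠ 0 := by
    by_contra! h
    exact hne (finsum_eq_zero_of_forall_eq_zero h)
  have h1 := hK' s (j + k) (right_ne_zero_of_mul hk)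
  have h2 : (s : ℚ) ≤ β * k + K := by
    by_cases h : diffOp (ψ k) s = 0
    · have h' : diffOp (ψ (k - 1)) s ≠ 0 := fun h' => left_ne_zero_of_mul hk (by rw [h, h']; rfl)
      have := SupportedBelow.le_of_diffOp_iterate hK 1 (k - 1) s h'
      push_cast at this
      nlinarith
    · exact SupportedBelow.le_of_diffOp_iterate hK 1 k s h
  have h3 : (s - K) / β ≤ k := by rw [div_le_iff₀ hβ]; linarith
  have h4 : (γ - 1 / β) * s + (K' + K / β) = γ * s + K' - (s - K) / β := by field_simp; ring
  push_cast at h1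
  linarith

/-- The kernel has mass one and is carried by $k\le s/\beta+1$, where $D\chi(s)(j+k)=1$. The extra
$1$ comes from the shifted term $k-1$ of the kernel and is what costs a unit of margin. -/
theorem StableBelow.collapse {d e : ℕ} (hψ : SupportedBelow ψ β) (hψ' : StableBelow ψ β d)
    (hβ : 0 < β) (hχ : StableBelow χ γ (e + 1)) : StableBelow (collapse ψ χ) (γ - 1 / β) e := by
  intro s j hs hj
  have := diffOp_iterate_finsum (φ := χ s) (finite_support_kernel hψ hψ' hβ s) 1 j
  simp only [iterate_one] at this
  rw [show PlumbingTree.collapse ψ χ s = fun j =>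
    ∑ᶠ k, (diffOp (ψ k) s - diffOp (ψ (k - 1)) s) * χ s (j + k) from rfl, this]
  refine Eq.trans (finsum_congr fun k => ?_) (finsum_kernel hψ hψ' hβ s)
  by_cases hk : (k : ℚ) ≤ s / β + 1
  · rw [hχ s (j + k) hs, mul_one]
    push_cast
    have h4 : (γ - 1 / β) * s = γ * s - s / β := by field_simp
    linarith
  -- Here both $k$ and $k-1$ are in the stable range of the leaf, so the kernel vanishes and the
  -- value of $D\chi$ is irrelevant.
  · push Not at hk
    have h0 : (0 : ℚ) ≤ s / β := by positivity
    have hk1 : (1 : ℚ) < k := by linarith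
    have hk1' : 1 < k := by exact_mod_cast hk1
    have hs1 : (s : ℚ) ≤ β * (k - 1) := by
      have : (s : ℚ) / β ≤ k - 1 := by linarith
      rw [div_le_iff₀ hβ] at this
      linarith
    have hd : (0 : ℚ) ≤ d := by positivity
    rw [hψ' k s (by omega) (by nlinarith), hψ' (k - 1) s (by omega) (by push_cast; linarith)]
    simp

/-- For $s\le 0$ the function $k\mapsto D\psi(k)(s)$ jumps from $0$ to $1$ exactly at $k=0$, so its
increment is the unit mass at $0$. -/
theorem collapse_eq_of_vanishing (hψ' : StableBelow ψ β d) (hβ : 0 < β)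
    (h0 : ∀ s < 0, ψ s = 0) {s : ℤ} (hs : s ≤ 0) : collapse ψ χ s = χ s := by
  have h1 : ∀ k, 0 ≤ k → diffOp (ψ k) s = 1 := by
    intro k hk
    refine hψ' k s hk ?_
    have h1 : (s : ℚ) ≤ 0 := by exact_mod_cast hs
    have h2 : (0 : ℚ) ≤ k := by exact_mod_cast hk
    have h3 : (0 : ℚ) ≤ d := by positivity
    nlinarith [mul_nonneg hβ.le h2]
  have h2 : ∀ k, k < 0 → diffOp (ψ k) s = 0 := by
    intro k hk
    simp [diffOp, h0 k hk]
  ext j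
  rw [collapse, finsum_eq_single _ 0]
  · simp [h1 0 le_rfl, h2 (-1) (by omega)]
  · intro k hk
    rcases lt_or_gt_of_ne hk with h | h
    · simp [h2 k h, h2 (k - 1) (by omega)]
    · simp [h1 k (by omega), h1 (k - 1) (by omega)]

/-- For $s\le 0\le k$ stability forces $D\psi(k)(s)=1$ for either weight, so the kernel sees the
leaf weight only at $k\le 0$. -/
theorem collapse_congr {ψ' χ' : ℤ → ℤ → ℤ} {β' : ℚ} {d' : ℕ} (h : StableBelow ψ β d)
    (h' : StableBelow ψ' β' d') (hβ : 0 < β) (hβ' : 0 < β') (hψ : ∀ s ≤ 0, ψ s = ψ' s)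
    {s : ℤ} (hs : s ≤ 0) (hχ : χ s = χ' s) : collapse ψ χ s = collapse ψ' χ' s := by
  have key : ∀ k, diffOp (ψ k) s = diffOp (ψ' k) s := by
    intro k
    rcases le_total k 0 with hk | hk
    · rw [hψ k hk]
    · have h1 : (s : ℚ) ≤ 0 := by exact_mod_cast hs
      have h2 : (0 : ℚ) ≤ k := by exact_mod_cast hk
      have h3 : (0 : ℚ) ≤ d := by positivity
      have h4 : (0 : ℚ) ≤ d' := by positivity
      rw [h k s hk (by nlinarith [mul_nonneg hβ.le h2]),
        h' k s hk (by nlinarith [mul_nonneg hβ'.le h2])]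
  ext j
  simp only [collapse, key, hχ]

theorem collapse_eq_zero {s : ℤ} (hχ : χ s = 0) : collapse ψ χ s = 0 := by
  ext j
  simp [collapse, hχ]

/-! ### Configurations on rooted trees and their leaves -/

variable {V : Type*} {G : SimpleGraph V}

/-- The neighbours of `v` in `A`. -/
noncomputable def nbrs (G : SimpleGraph V) (A : Finset V) (v : V) : Finset V := A.filter (G.Adj v)

theorem mem_nbrs {A : Finset V} {v x : V} : x ∈ nbrs G A v ↔ x ∈ A ∧ G.Adj v x := by
  simp [nbrs]

/-- Integer-valued functions on `V` that vanish outside `A`. -/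
abbrev SupportedOn (A : Finset V) : Type _ := {n : V → ℤ // ∀ v ∉ A, n v = 0}

/-- The weight of the configuration `n` on the full subgraph on `A`. -/
noncomputable def weight (G : SimpleGraph V) (A : Finset V) (ψ : V → ℤ → ℤ → ℤ) (n : V → ℤ) : ℤ :=
  ∏ v ∈ A, diffOp^[(nbrs G A v).card] (ψ v (n v)) (∑ x ∈ nbrs G A v, n x)

/-- The sum of the weights of all configurations on the full subgraph on `A`. -/
noncomputable def stateSum (G : SimpleGraph V) (A : Finset V) (ψ : V → ℤ → ℤ → ℤ) : ℤ :=
  ∑ᶠ n : SupportedOn A, weight G A ψ n.1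

/-- A rooted tree structure on `G` with root `w`. -/
structure Rooting (G : SimpleGraph V) (w : V) where
  parent : V → V
  depth : V → ℕ
  adj_parent : ∀ v, v ≠ w → G.Adj v (parent v)
  depth_parent : ∀ v, v ≠ w → depth (parent v) < depth v
  eq_parent : ∀ u v, G.Adj u v → v ≠ w ∧ u = parent v ∨ u ≠ w ∧ v = parent u

namespace Rooting

variable {w : V} (R : Rooting G w)

/-- `A` spans a subtree that contains the root. -/
def Closed (A : Finset V) : Prop := w ∈ A ∧ ∀ v ∈ A, v ≠ w → R.parent v ∈ A

variable {R} {A : Finset V}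

theorem exists_max_depth (hA : R.Closed A) (hne : A ≠ {w}) :
    ∃ u ∈ A, u ≠ w ∧ ∀ v ∈ A, v ≠ w → R.parent v ≠ u := by
  have h1 : (A.erase w).Nonempty := by
    rw [Finset.nonempty_iff_ne_empty]
    intro h
    apply hne
    rw [← Finset.insert_erase hA.1, h]
    rfl
  obtain ⟨u, hu, hmax⟩ := Finset.exists_max_image (A.erase w) R.depth h1
  rw [Finset.mem_erase] at hu
  refine ⟨u, hu.2, hu.1, fun v hv hvw h => ?_⟩
  have h2 := R.depth_parent v hvw
  have h3 := hmax v (Finset.mem_erase.2 ⟨hvw, hv⟩)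
  rw [h] at h2
  omega

theorem Closed.erase {u : V} (hA : R.Closed A) (huw : u ≠ w)
    (hu : ∀ v ∈ A, v ≠ w → R.parent v ≠ u) : R.Closed (A.erase u) := by
  refine ⟨Finset.mem_erase.2 ⟨huw.symm, hA.1⟩, fun v hv hvw => ?_⟩
  rw [Finset.mem_erase] at hv
  exact Finset.mem_erase.2 ⟨hu v hv.2 hvw, hA.2 v hv.2 hvw⟩

theorem Closed.nbrs_leaf {u : V} (hA : R.Closed A) (huA : u ∈ A) (huw : u ≠ w)
    (hu : ∀ v ∈ A, v ≠ w → R.parent v ≠ u) : nbrs G A u = {R.parent u} := by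
  ext x
  rw [mem_nbrs, Finset.mem_singleton]
  constructor
  · rintro ⟨hx, hadj⟩
    rcases R.eq_parent u x hadj with h | h
    · exact absurd h.2.symm (hu x hx h.1)
    · exact h.2
  · rintro rfl
    exact ⟨hA.2 u huA huw, R.adj_parent u huw⟩

end Rooting

/-- `u` is a leaf of the full subgraph on `A`, attached to `v`. -/
structure IsLeaf (G : SimpleGraph V) (A : Finset V) (u v : V) : Prop where
  mem : u ∈ A
  nbrs_eq : nbrs G A u = {v}

namespace IsLeaf

variable {A : Finset V} {u v : V} (h : IsLeaf G A u v)
include h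

theorem adj : G.Adj u v := (mem_nbrs.1 (h.nbrs_eq ▸ Finset.mem_singleton_self v)).2

theorem mem_right : v ∈ A := (mem_nbrs.1 (h.nbrs_eq ▸ Finset.mem_singleton_self v)).1

theorem ne : u ≠ v := h.adj.ne

theorem mem_erase : v ∈ A.erase u := Finset.mem_erase.2 ⟨h.ne.symm, h.mem_right⟩

theorem nbrs_right : nbrs G A v = insert u (nbrs G (A.erase u) v) := by
  ext x
  simp only [mem_nbrs, Finset.mem_insert, Finset.mem_erase]
  constructor
  · rintro ⟨h1, h2⟩
    by_cases hx : x = u <;> simp [*]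
  · rintro (rfl | ⟨⟨_, h1⟩, h2⟩)
    · exact ⟨h.mem, h.adj.symm⟩
    · exact ⟨h1, h2⟩

omit h in
theorem notMem_nbrs_erase (x : V) : u ∉ nbrs G (A.erase u) x := by simp [mem_nbrs]

theorem card_nbrs_right : (nbrs G A v).card = (nbrs G (A.erase u) v).card + 1 := by
  rw [h.nbrs_right, Finset.card_insert_of_notMem (notMem_nbrs_erase v)]

theorem nbrs_other {x : V} (hx : x ∈ A) (hxv : x ≠ v) : nbrs G (A.erase u) x = nbrs G A x := by
  ext y
  simp only [mem_nbrs, Finset.mem_erase]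
  constructor
  · rintro ⟨⟨_, h1⟩, h2⟩
    exact ⟨h1, h2⟩
  · rintro ⟨h1, h2⟩
    refine ⟨⟨?_, h1⟩, h2⟩
    rintro rfl
    have : x ∈ nbrs G A y := mem_nbrs.2 ⟨hx, h2.symm⟩
    rw [h.nbrs_eq, Finset.mem_singleton] at this
    exact hxv this

theorem sum_right {M : Type*} [AddCommMonoid M] (f : V → M) :
    ∑ x ∈ nbrs G A v, f x = f u + ∑ x ∈ nbrs G (A.erase u) v, f x := by
  rw [h.nbrs_right, Finset.sum_insert (notMem_nbrs_erase v)]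

/-- Splitting off the leaf variable. -/
noncomputable def splitEquiv : SupportedOn (A.erase u) × ℤ ≃ SupportedOn A where
  toFun p := ⟨update p.1.1 u p.2, fun x hx => by
    have hxu : x ≠ u := fun e => hx (e ▸ h.mem)
    rw [update_of_ne hxu]
    exact p.1.2 x fun hx' => hx (Finset.mem_of_mem_erase hx')⟩
  invFun n := (⟨update n.1 u 0, fun x hx => by
    by_cases hxu : x = u
    · simp [hxu]
    · rw [update_of_ne hxu]
      exact n.2 x fun hx' => hx (Finset.mem_erase.2 ⟨hxu, hx'⟩)⟩, n.1 u)
  left_inv p := by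
    have : p.1.1 u = 0 := p.1.2 u (by simp)
    refine Prod.ext (Subtype.ext ?_) ?_
    · simp [← this]
    · simp
  right_inv n := Subtype.ext (by simp)

theorem weight_update (ψ : V → ℤ → ℤ → ℤ) (m : V → ℤ) (k : ℤ) :
    weight G A ψ (update m u k) =
      (∏ x ∈ (A.erase u).erase v,
        diffOp^[(nbrs G (A.erase u) x).card] (ψ x (m x)) (∑ y ∈ nbrs G (A.erase u) x, m y)) *
      (diffOp (ψ u k) (m v) * diffOp^[(nbrs G (A.erase u) v).card + 1] (ψ v (m v))
        ((∑ y ∈ nbrs G (A.erase u) v, m y) + k)) := by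
  have hsum : ∀ x, ∑ y ∈ nbrs G (A.erase u) x, update m u k y
      = ∑ y ∈ nbrs G (A.erase u) x, m y := fun x =>
    Finset.sum_congr rfl fun y hy => update_of_ne (fun e => notMem_nbrs_erase x (e ▸ hy)) _ _
  rw [weight, ← Finset.mul_prod_erase A _ h.mem, ← Finset.mul_prod_erase _ _ h.mem_erase]
  have h1 : ∏ x ∈ (A.erase u).erase v, diffOp^[(nbrs G A x).card] (ψ x (update m u k x))
      (∑ y ∈ nbrs G A x, update m u k y) = ∏ x ∈ (A.erase u).erase v,
        diffOp^[(nbrs G (A.erase u) x).card] (ψ x (m x)) (∑ y ∈ nbrs G (A.erase u) x, m y) := by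
    refine Finset.prod_congr rfl fun x hx => ?_
    simp only [Finset.mem_erase] at hx
    rw [← h.nbrs_other hx.2.2 hx.1, hsum, update_of_ne hx.2.1]
  rw [h1, h.nbrs_eq, h.card_nbrs_right, h.sum_right, hsum]
  simp only [Finset.card_singleton, iterate_one, update_self, Finset.sum_singleton,
    update_of_ne h.ne.symm]
  rw [add_comm k]
  ring

/-- The leaf variable enters only the factors at $u$ and $v$, so Fubini reduces this to
`finsum_leaf`. Finite support is what permits the iterated sum. -/
theorem stateSum_collapse {ψ : V → ℤ → ℤ → ℤ} {β γ : ℚ} {d : ℕ}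
    (hu : SupportedBelow (ψ u) β) (hu' : StableBelow (ψ u) β d) (hβ : 0 < β)
    (hv : SupportedBelow (ψ v) γ)
    (hfin : (support fun n : SupportedOn A => weight G A ψ n.1).Finite) :
    stateSum G A ψ = stateSum G (A.erase u) (update ψ v (collapse (ψ u) (ψ v))) := by
  rw [stateSum, ← finsum_comp_equiv h.splitEquiv, finsum_curry]
  · refine finsum_congr fun m => ?_
    rw [weight, ← Finset.mul_prod_erase _ _ h.mem_erase, update_self, ← finsum_leaf hu hu' hβ hv,
      mul_comm, mul_finsum]
    refine finsum_congr fun k => ?_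
    rw [splitEquiv, Equiv.coe_fn_mk, h.weight_update]
    congr 1
    refine Finset.prod_congr rfl fun x hx => ?_
    rw [update_of_ne (Finset.ne_of_mem_erase hx)]
  · exact hfin.preimage h.splitEquiv.injective.injOn

end IsLeaf

/-! ### Gaussian elimination and finiteness -/

/-- Positivity of `∑_v β_v x_v² - ∑_{v ∼ w} x_v x_w` over the full subgraph on `A`, witnessed by a
positive vector. -/
def Dominant (G : SimpleGraph V) (A : Finset V) (r β : V → ℚ) : Prop :=
  ∀ v ∈ A, ∑ x ∈ nbrs G A v, r x < β v * r v

variable {A : Finset V} {r β : V → ℚ}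

theorem Dominant.pos (h : Dominant G A r β) (hr : ∀ v, 0 < r v) {v : V} (hv : v ∈ A) : 0 < β v :=
  pos_of_mul_pos_left (lt_of_le_of_lt (Finset.sum_nonneg fun x _ => (hr x).le) (h v hv)) (hr v).le

theorem Dominant.mono {B : Finset V} (h : Dominant G A r β) (hr : ∀ v, 0 < r v) (hBA : B ⊆ A) :
    Dominant G B r β := fun v hv =>
  lt_of_le_of_lt (Finset.sum_le_sum_of_subset_of_nonneg (Finset.filter_subset_filter _ hBA)
    fun x _ _ => (hr x).le) (h v (hBA hv))

/-- The leaf inequality $r_v<\beta_ur_u$ bounds $r_u$ below by $r_v/\beta_u$; substituting this at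
$v$ shows that the same vector $r$ witnesses the eliminated system. -/
theorem Dominant.collapse {u v : V} (h : Dominant G A r β) (hr : ∀ v, 0 < r v)
    (hl : IsLeaf G A u v) : Dominant G (A.erase u) r (update β v (β v - 1 / β u)) := by
  intro x hx
  have hxA := Finset.mem_of_mem_erase hx
  by_cases hxv : x = v
  · subst hxv
    have h1 := h x hxA
    have h2 := h u hl.mem
    have h3 := h.pos hr hl.mem
    rw [hl.sum_right] at h1
    rw [hl.nbrs_eq, Finset.sum_singleton] at h2
    have h4 : r x / β u < r u := by rw [div_lt_iff₀ h3]; linarith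
    rw [update_self]
    have h5 : (β x - 1 / β u) * r x = β x * r x - r x / β u := by ring
    linarith
  · rw [hl.nbrs_other hxA hxv, update_of_ne hxv]
    exact h x hxA

/-- Finiteness of the set of configurations that are bounded in the sense of the positive
definite form and negative at the root. -/
theorem finite_configurations {w : V} (R : Rooting G w) (hr : ∀ v, 0 < r v) (N : ℕ) :
    ∀ (A : Finset V) (β K : V → ℚ), A.card = N → R.Closed A → Dominant G A r β →
      {n : SupportedOn A | n.1 w < 0 ∧ ∀ v ∈ A,
        ((∑ x ∈ nbrs G A v, n.1 x : ℤ) : ℚ) ≤ β v * n.1 v + K v}.Finite := by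
  induction N with
  | zero =>
    intro A β K hN hA
    exact absurd hA.1 (by simp [Finset.card_eq_zero.1 hN])
  | succ N ih =>
    intro A β K hN hA hdom
    by_cases hAw : A = {w}
    · subst hAw
      have hβ := hdom.pos hr (Finset.mem_singleton_self w)
      refine Set.Finite.of_finite_fibers (fun n => n.1 w)
        ((Set.finite_Icc ⌈-K w / β w⌉ 0).subset ?_) fun a _ => Set.Subsingleton.finite ?_
      · rintro _ ⟨n, ⟨h1, h2⟩, rfl⟩
        refine ⟨Int.ceil_le.2 ?_, h1.le⟩
        have h3 := h2 w (Finset.mem_singleton_self w)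
        have h4 : nbrs G {w} w = ∅ := by
          ext x
          simp only [mem_nbrs, Finset.mem_singleton, Finset.notMem_empty, iff_false]
          rintro ⟨rfl, hx⟩
          exact hx.ne rfl
        rw [h4, Finset.sum_empty] at h3
        rw [div_le_iff₀ hβ]
        push_cast at h3
        linarith
      · rintro n ⟨_, hn⟩ m ⟨_, hm⟩
        apply Subtype.ext
        ext x
        by_cases hx : x = w
        · subst hx
          simp only [Set.mem_preimage, Set.mem_singleton_iff] at hn hm
          rw [hn, hm]
        · rw [n.2 x (by simpa using hx), m.2 x (by simpa using hx)]
    · obtain ⟨u, huA, huw, hu⟩ := Rooting.exists_max_depth hA hAw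
      have hl : IsLeaf G A u (R.parent u) := ⟨huA, hA.nbrs_leaf huA huw hu⟩
      set v := R.parent u with hv
      have hβ := hdom.pos hr huA
      -- The leaf inequality gives $n_u\ge(n_v-K_u)/\beta_u$; substituting it at $v$ yields the new
      -- slope and constant.
      have hfin := ih (A.erase u) (update β v (β v - 1 / β u)) (update K v (K v + K u / β u))
        (by rw [Finset.card_erase_of_mem huA]; omega) (hA.erase huw hu) (hdom.collapse hr hl)
      refine Set.Finite.of_finite_fibers (fun n => (hl.splitEquiv.symm n).1) (hfin.subset ?_)
        fun m _ => ?_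
      · rintro _ ⟨n, ⟨h1, h2⟩, rfl⟩
        have hval : ∀ x, x ≠ u → (hl.splitEquiv.symm n).1.1 x = n.1 x := fun x hx =>
          update_of_ne hx _ _
        have hsum : ∀ x, ∑ y ∈ nbrs G (A.erase u) x, (hl.splitEquiv.symm n).1.1 y
            = ∑ y ∈ nbrs G (A.erase u) x, n.1 y := fun x =>
          Finset.sum_congr rfl fun y hy =>
            hval y fun e => IsLeaf.notMem_nbrs_erase x (e ▸ hy)
        refine ⟨by rw [hval w huw.symm]; exact h1, fun x hx => ?_⟩
        rw [hsum, hval x (Finset.ne_of_mem_erase hx)]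
        have hxA := Finset.mem_of_mem_erase hx
        have h3 := h2 x hxA
        by_cases hxv : x = v
        · subst hxv
          rw [update_self, update_self]
          rw [hl.sum_right] at h3
          have h4 := h2 u huA
          rw [hl.nbrs_eq, Finset.sum_singleton] at h4
          have h5 : ((n.1 v : ℚ) - K u) / β u ≤ n.1 u := by rw [div_le_iff₀ hβ]; linarith
          have h6 : (β v - 1 / β u) * (n.1 v : ℚ) + (K v + K u / β u)
            = β v * n.1 v + K v - ((n.1 v : ℚ) - K u) / β u := by ring
          push_cast at h3 ⊢
          linarith
        · rw [update_of_ne hxv, update_of_ne hxv, hl.nbrs_other hxA hxv]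
          exact h3
      -- With the other values fixed, the inequality at $u$ bounds $n_u$ from below and the one at
      -- $v$ bounds it from above.
      · refine Set.Finite.of_finite_fibers (fun n => n.1 u)
          ((Set.finite_Icc ⌈((m.1 v : ℚ) - K u) / β u⌉
            ⌊β v * m.1 v + K v - (∑ y ∈ nbrs G (A.erase u) v, m.1 y : ℤ)⌋).subset ?_)
          fun a _ => Set.Subsingleton.finite ?_
        · rintro _ ⟨n, ⟨⟨h1, h2⟩, rfl⟩, rfl⟩
          have hval : ∀ x, x ≠ u → (hl.splitEquiv.symm n).1.1 x = n.1 x := fun x hx =>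
            update_of_ne hx _ _
          have hsum : ∀ x, ∑ y ∈ nbrs G (A.erase u) x, (hl.splitEquiv.symm n).1.1 y
              = ∑ y ∈ nbrs G (A.erase u) x, n.1 y := fun x =>
            Finset.sum_congr rfl fun y hy =>
              hval y fun e => IsLeaf.notMem_nbrs_erase x (e ▸ hy)
          have h3 := h2 v hl.mem_right
          have h4 := h2 u huA
          rw [hl.nbrs_eq, Finset.sum_singleton] at h4
          rw [hl.sum_right] at h3
          push_cast at h3
          simp only [Set.mem_Icc, Int.ceil_le, Int.le_floor]
          rw [hsum, hval v hl.ne.symm, div_le_iff₀ hβ]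
          push_cast
          constructor <;> linarith
        · rintro n ⟨⟨_, hn⟩, hn'⟩ m' ⟨⟨_, hm⟩, hm'⟩
          simp only [Set.mem_preimage, Set.mem_singleton_iff] at hn hn' hm hm'
          apply hl.splitEquiv.symm.injective
          refine Prod.ext (hn.trans hm.symm) ?_
          exact hn'.trans hm'.symm

/-! ### Collapsing towards the root -/

/-- The hypotheses on the vertex weights under which leaves can be collapsed towards the root. -/
structure Admissible {w : V} (R : Rooting G w) (r : V → ℚ) (A : Finset V) (ψ : V → ℤ → ℤ → ℤ)
    (β : V → ℚ) : Prop where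
  closed : R.Closed A
  dominant : Dominant G A r β
  supported : ∀ v ∈ A, SupportedBelow (ψ v) (β v)
  stable : ∀ v ∈ A, v ≠ w → StableBelow (ψ v) (β v) (nbrs G A v).card
  root : ∀ s, 0 ≤ s → ψ w s = 0

namespace Admissible

variable {w : V} {R : Rooting G w} {ψ : V → ℤ → ℤ → ℤ}

/-- A non-zero weight forces the support inequality at every vertex and a negative value at the
root. -/
theorem finite_support (hr : ∀ v, 0 < r v) (h : Admissible R r A ψ β) :
    (support fun n : SupportedOn A => weight G A ψ n.1).Finite := by
  choose! K hK using h.supported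
  refine (finite_configurations R hr A.card A β K rfl h.closed h.dominant).subset fun n hn => ?_
  have hne := fun v hv => Finset.prod_ne_zero_iff.1 hn v hv
  constructor
  · by_contra! hw
    have := hne w h.closed.1
    rw [h.root _ hw] at this
    exact this (diffOp_iterate_eq_zero (b := (∑ x ∈ nbrs G A w, n.1 x) - 1) (fun _ _ => rfl) _ _
      (by omega))
  · intro v hv
    exact SupportedBelow.le_of_diffOp_iterate (hK v hv) _ _ _ (hne v hv)

/-- Removing $u$ lowers the number of neighbours of $v$ by one, which matches the unit of margin
lost. The root is never absorbed as a leaf, so no stability is required there. -/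
theorem collapse {u v : V} (hr : ∀ v, 0 < r v) (h : Admissible R r A ψ β) (hl : IsLeaf G A u v)
    (huw : u ≠ w) (hcl : R.Closed (A.erase u)) :
    Admissible R r (A.erase u) (update ψ v (PlumbingTree.collapse (ψ u) (ψ v)))
      (update β v (β v - 1 / β u)) where
  closed := hcl
  dominant := h.dominant.collapse hr hl
  supported x hx := by
    have hxA := Finset.mem_of_mem_erase hx
    by_cases hxv : x = v
    · subst hxv
      simp only [update_self]
      exact (h.supported u hl.mem).collapse (h.dominant.pos hr hl.mem) (h.supported x hxA)
    · simp only [update_of_ne hxv]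
      exact h.supported x hxA
  stable x hx hxw := by
    have hxA := Finset.mem_of_mem_erase hx
    by_cases hxv : x = v
    · subst hxv
      simp only [update_self]
      refine StableBelow.collapse (h.supported u hl.mem) (h.stable u hl.mem huw)
        (h.dominant.pos hr hl.mem) ?_
      rw [← hl.card_nbrs_right]
      exact h.stable x hxA hxw
    · simp only [update_of_ne hxv]
      rw [hl.nbrs_other hxA hxv]
      exact h.stable x hxA hxw
  root s hs := by
    by_cases hwv : w = v
    · subst hwv
      simp only [update_self]
      exact collapse_eq_zero (h.root s hs)
    · simp only [update_of_ne hwv]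
      exact h.root s hs

theorem stateSum_collapse {u v : V} (hr : ∀ v, 0 < r v) (h : Admissible R r A ψ β)
    (hl : IsLeaf G A u v) (huw : u ≠ w) :
    stateSum G A ψ = stateSum G (A.erase u) (update ψ v (PlumbingTree.collapse (ψ u) (ψ v))) :=
  hl.stateSum_collapse (h.supported u hl.mem) (h.stable u hl.mem huw) (h.dominant.pos hr hl.mem)
    (h.supported v hl.mem_right) (h.finite_support hr)

end Admissible

/-- The state sum negative at the root is not changed when branches whose first vertex
is constrained to be non-negative are removed. -/
theorem stateSum_eq_of_subset {w : V} (R : Rooting G w) (hr : ∀ v, 0 < r v) (N : ℕ) :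
    ∀ (A B : Finset V) (ψ χ : V → ℤ → ℤ → ℤ) (β γ : V → ℚ), A.card = N → B ⊆ A →
      Admissible R r A ψ β → Admissible R r B χ γ → (∀ v ∈ B, ∀ s ≤ 0, ψ v s = χ v s) →
      (∀ u ∈ A, u ∉ B → (∃ v ∈ B, G.Adj u v) → ∀ s < 0, ψ u s = 0) →
      stateSum G A ψ = stateSum G B χ := by
  induction N with
  | zero =>
    intro A B ψ χ β γ hN _ hA
    exact absurd hA.closed.1 (by simp [Finset.card_eq_zero.1 hN])
  | succ N ih =>
    intro A B ψ χ β γ hN hBA hA hB heq hbd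
    by_cases hAw : A = {w}
    · have hBw : B = {w} := by
        refine Finset.Subset.antisymm (hAw ▸ hBA) ?_
        simpa using hB.closed.1
      subst hAw hBw
      refine finsum_congr fun n => ?_
      simp only [weight, Finset.prod_singleton]
      rcases le_total (n.1 w) 0 with h | h
      · rw [heq w (by simp) _ h]
      · rw [hA.root _ h, hB.root _ h]
    · obtain ⟨u, huA, huw, hu⟩ := Rooting.exists_max_depth hA.closed hAw
      have hl : IsLeaf G A u (R.parent u) := ⟨huA, hA.closed.nbrs_leaf huA huw hu⟩
      have hcl := hA.closed.erase huw hu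
      set v := R.parent u with hv
      have hcard : (A.erase u).card = N := by rw [Finset.card_erase_of_mem huA]; omega
      have hβ := hA.dominant.pos hr huA
      have hA' := hA.collapse hr hl huw hcl
      rw [hA.stateSum_collapse hr hl huw]
      -- A common leaf is collapsed on both sides, preserving agreement at non-positive arguments.
      by_cases huB : u ∈ B
      · have hlB : IsLeaf G B u v :=
          ⟨huB, hB.closed.nbrs_leaf huB huw fun x hx => hu x (hBA hx)⟩
        have hclB := hB.closed.erase huw fun x hx => hu x (hBA hx)
        rw [hB.stateSum_collapse hr hlB huw]
        refine ih _ _ _ _ _ _ hcard (Finset.erase_subset_erase u hBA) hA'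
          (hB.collapse hr hlB huw hclB) ?_ ?_
        · intro x hx s hs
          have hxB := Finset.mem_of_mem_erase hx
          by_cases hxv : x = v
          · subst hxv
            simp only [update_self]
            exact collapse_congr (hA.stable u huA huw) (hB.stable u huB huw) hβ
              (hB.dominant.pos hr huB) (heq u huB) hs (heq v hxB s hs)
          · simp only [update_of_ne hxv]
            exact heq x hxB s hs
        · rintro x hx hxB ⟨y, hy, hxy⟩ s hs
          rw [Finset.mem_erase] at hx hy
          have hxB' : x ∉ B := fun h => hxB (Finset.mem_erase.2 ⟨hx.1, h⟩)
          have hxv : x ≠ v := fun h => hxB' (h ▸ hlB.mem_right)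
          rw [update_of_ne hxv]
          exact hbd x hx.2 hxB' ⟨y, hy.2, hxy⟩ s hs
      -- A leaf outside $B$ is collapsed in $A$ only. If its parent is in $B$, the leaf is
      -- constrained and the collapse is invisible for $s\le 0$; otherwise a vanishing condition at
      -- the parent is inherited.
      · refine ih _ _ _ _ _ _ hcard (fun x hx => Finset.mem_erase.2 ⟨?_, hBA hx⟩) hA' hB ?_ ?_
        · rintro rfl
          exact huB hx
        · intro x hx s hs
          by_cases hxv : x = v
          · subst hxv
            rw [update_self, collapse_eq_of_vanishing (hA.stable u huA huw) hβ
              (hbd u huA huB ⟨v, hx, hl.adj⟩) hs]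
            exact heq v hx s hs
          · rw [update_of_ne hxv]
            exact heq x hx s hs
        · rintro x hx hxB hy s hs
          rw [Finset.mem_erase] at hx
          have h0 := hbd x hx.2 hxB hy s hs
          by_cases hxv : x = v
          · subst hxv
            rw [update_self]
            exact collapse_eq_zero h0
          · rw [update_of_ne hxv]
            exact h0

/-! ### The coefficients of the Poincaré series as local weights -/

section Coefficients

variable {V : Type*} [Fintype V]

/-- The weight with `baseWeight (-b)` the coefficient of `x ^ b` in `(1 - x)⁻²`. -/
def baseWeight (j : ℤ) : ℤ := max (1 - j) 0

/-- The power series with coefficients `∏ v, φ_v(-b_v)`. -/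
def productSeries (φ : V → ℤ → ℤ) : MvPowerSeries V ℤ := fun b => ∏ v, φ v (-(b v : ℤ))

theorem coeff_productSeries (φ : V → ℤ → ℤ) (b : V →₀ ℕ) :
    MvPowerSeries.coeff b (productSeries φ) = ∏ v, φ v (-(b v : ℤ)) := rfl

/-- The sign in $\varphi_v(-b_v)$ turns multiplication by $1-x_w$ into `diffOp`; vanishing at $j=1$
covers the case $b_w=0$. -/
theorem productSeries_mul_one_sub_X (φ : V → ℤ → ℤ) (w : V) (h : ∀ j, 0 < j → φ w j = 0) :
    productSeries φ * (1 - MvPowerSeries.X w) = productSeries (update φ w (diffOp (φ w))) := by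
  ext b
  rw [mul_sub, mul_one, map_sub, MvPowerSeries.X, MvPowerSeries.coeff_mul_monomial,
    coeff_productSeries φ b, coeff_productSeries (update _ _ _) b, mul_one,
    ← Finset.mul_prod_erase _ (fun v => φ v (-(b v : ℤ))) (Finset.mem_univ w),
    ← Finset.mul_prod_erase _ (fun v => update φ w (diffOp (φ w)) v _) (Finset.mem_univ w),
    update_self]
  have h1 : ∏ x ∈ Finset.univ.erase w, update φ w (diffOp (φ w)) x (-(b x : ℤ))
      = ∏ x ∈ Finset.univ.erase w, φ x (-(b x : ℤ)) :=
    Finset.prod_congr rfl fun x hx => by rw [update_of_ne (Finset.ne_of_mem_erase hx)]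
  rw [h1, diffOp]
  by_cases hb : b w = 0
  · rw [if_neg (by simp [hb]), hb, h (-((0 : ℕ) : ℤ) + 1) (by simp)]
    ring
  · rw [if_pos (by simpa using Nat.one_le_iff_ne_zero.2 hb), coeff_productSeries,
      ← Finset.mul_prod_erase _ _ (Finset.mem_univ w)]
    have h2 : ∏ x ∈ Finset.univ.erase w, φ x (-(((b - Finsupp.single w 1 : V →₀ ℕ) x : ℕ) : ℤ))
        = ∏ x ∈ Finset.univ.erase w, φ x (-(b x : ℤ)) := by
      refine Finset.prod_congr rfl fun x hx => ?_
      simp [(Finset.ne_of_mem_erase hx).symm]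
    rw [h2]
    have h3 : -(((b - Finsupp.single w 1 : V →₀ ℕ) w : ℕ) : ℤ) = -(b w : ℤ) + 1 := by
      simp only [Finsupp.coe_tsub, Pi.sub_apply, Finsupp.single_eq_same]
      omega
    rw [h3]
    ring

theorem productSeries_mul_pow (φ : V → ℤ → ℤ) (w : V) (h : ∀ j, 0 < j → φ w j = 0) (d : ℕ) :
    productSeries φ * (1 - MvPowerSeries.X w) ^ d
      = productSeries (update φ w (diffOp^[d] (φ w))) := by
  induction d with
  | zero => simp
  | succ d ih =>
    rw [pow_succ, ← mul_assoc, ih, productSeries_mul_one_sub_X]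
    · simp [iterate_succ_apply']
    · simpa using diffOp_iterate_eq_zero h d

theorem productSeries_mul_prod (φ : V → ℤ → ℤ) (h : ∀ v j, 0 < j → φ v j = 0) (d : V → ℕ)
    (S : Finset V) : productSeries φ * ∏ v ∈ S, (1 - MvPowerSeries.X v) ^ d v
      = productSeries fun v => if v ∈ S then diffOp^[d v] (φ v) else φ v := by
  induction S using Finset.induction_on with
  | empty => simp
  | insert w S hw ih =>
    rw [Finset.prod_insert hw, mul_comm (_ ^ _), ← mul_assoc, ih, productSeries_mul_pow]
    · congr 1
      ext v : 1
      by_cases hv : v = w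
      · subst hv; simp [hw]
      · simp [hv]
    · simpa [hw] using h w

theorem baseWeight_eq_zero {j : ℤ} (h : 0 < j) : baseWeight j = 0 := by
  simp only [baseWeight]; omega

theorem diffOp_diffOp_baseWeight (j : ℤ) : diffOp^[2] baseWeight j = if j = 0 then 1 else 0 := by
  simp only [iterate_succ, iterate_zero, comp_apply, id_eq, diffOp, baseWeight]
  split_ifs <;> omega

/-- The exponent $\delta_v-2$ may be negative. Since the second difference of `baseWeight` is the
unit mass at $0$, its product series inverts $\prod_v(1-x_v)^2$; the remaining $\delta_v$ factors
act as differences. -/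
theorem coeff_Zx (T : PlumbingTree V) (b : V →₀ ℕ) :
    MvPowerSeries.coeff b T.Zx = ∏ v, diffOp^[T.graph.degree v] baseWeight (-(b v : ℤ)) := by
  have h0 : ∀ (v : V) (j : ℤ), 0 < j → (fun _ : V => baseWeight) v j = 0 := fun _ _ =>
    baseWeight_eq_zero
  have h2 := productSeries_mul_prod _ h0 (fun _ => 2) Finset.univ
  have hd := productSeries_mul_prod _ h0 (fun v => T.graph.degree v) Finset.univ
  have h1 : productSeries (fun _ : V => diffOp^[2] baseWeight) = 1 := by
    ext b
    rw [coeff_productSeries, MvPowerSeries.coeff_one]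
    simp only [diffOp_diffOp_baseWeight, neg_eq_zero, Nat.cast_eq_zero]
    split_ifs with hb
    · simp [hb]
    · obtain ⟨v, hv⟩ := Finsupp.ne_iff.1 hb
      exact Finset.prod_eq_zero (Finset.mem_univ v) (if_neg hv)
  simp only [Finset.mem_univ, if_true] at h2 hd
  rw [h1] at h2
  have hu : (∏ v, oneSubX v ^ ((T.graph.degree v : ℤ) - 2)) * ∏ v : V, oneSubX v ^ 2
      = ∏ v, oneSubX v ^ (T.graph.degree v) := by
    rw [← Finset.prod_mul_distrib]
    refine Finset.prod_congr rfl fun v _ => ?_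
    rw [← zpow_natCast, ← zpow_natCast, ← zpow_add]
    congr 1
    push_cast
    ring
  have hu' : T.Zx * ∏ v : V, (1 - MvPowerSeries.X v) ^ 2
      = ∏ v : V, (1 - MvPowerSeries.X v) ^ T.graph.degree v := by
    have := congrArg (Units.val) hu
    simpa [Units.coe_prod, Zx, oneSubX] using this
  have hZ : T.Zx = productSeries fun v => diffOp^[T.graph.degree v] baseWeight := by
    rw [← hd, ← hu', mul_left_comm, h2, mul_one]
  rw [hZ, coeff_productSeries]

variable (T : PlumbingTree V)

theorem sum_Estar_injective {c c' : V → ℤ} (h : ∑ v, c v • T.Estar v = ∑ v, c' v • T.Estar v) :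
    c = c' := by
  have h1 := Fintype.linearIndependent_iff.1 T.linearIndependent_Estar (fun v => c v - c' v)
    (by simp [sub_smul, h])
  exact funext fun v => sub_eq_zero.1 (h1 v)

theorem z_sum_Estar (c : V → ℤ) :
    T.z (∑ v, c v • T.Estar v) = ∏ v, diffOp^[T.graph.degree v] baseWeight (-(c v)) := by
  have key : ∀ b : V →₀ ℕ, ∑ v, b v • T.Estar v = ∑ v, c v • T.Estar v ↔ ∀ v, (b v : ℤ) = c v := by
    intro b
    constructor
    · intro h v
      exact congrFun (T.sum_Estar_injective (c := fun v => (b v : ℤ)) (by simpa using h)) v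
    · intro h
      refine Finset.sum_congr rfl fun v _ => ?_
      rw [← h v, natCast_zsmul]
  unfold z
  simp only [key]
  by_cases hc : ∀ v, 0 ≤ c v
  · have hb : ∀ v, ((Finsupp.equivFunOnFinite.symm fun v => (c v).toNat : V →₀ ℕ) v : ℤ) = c v := by
      intro v
      simp [hc v]
    rw [finsum_eq_single _ (Finsupp.equivFunOnFinite.symm fun v => (c v).toNat)]
    · rw [finsum_eq_if, if_pos hb, coeff_Zx]
      simp only [hb]
    · intro b hne
      rw [finsum_eq_if, if_neg]
      intro h
      apply hne
      ext v
      have h1 := h v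
      have h2 := hb v
      omega
  -- A negative coordinate is the exponent of no monomial, and the local factor vanishes there too.
  · push Not at hc
    obtain ⟨v, hv⟩ := hc
    rw [Finset.prod_eq_zero (Finset.mem_univ v)
      (diffOp_iterate_eq_zero (b := 0) (fun _ => baseWeight_eq_zero) _ _ (by omega))]
    refine finsum_eq_zero_of_forall_eq_zero fun b => ?_
    rw [finsum_eq_if, if_neg]
    intro h
    have := h v
    omega

theorem mulVec_sum_Estar (a : V → ℤ) (v : V) :
    T.intMatrix.mulVec ((∑ v, a v • T.Estar v : T.dualLattice) : V → ℚ) v = -(a v : ℚ) := by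
  have h1 : ((∑ v, a v • T.Estar v : T.dualLattice) : V → ℚ)
      = ∑ v, (a v : ℚ) • T.EstarVec v := by
    simp [Estar, ← Int.cast_smul_eq_zsmul ℚ]
  rw [h1, Matrix.mulVec_sum, Finset.sum_apply, Finset.sum_eq_single v]
  · simp [Matrix.mulVec_smul, mulVec_EstarVec]
  · intro x _ hx
    simp [Matrix.mulVec_smul, mulVec_EstarVec, hx.symm]
  · simp

theorem eq_sum_Estar (x : T.dualLattice) (c : V → ℤ)
    (h : ∀ v, T.intMatrix.mulVec (x : V → ℚ) v = -(c v : ℚ)) : x = ∑ v, c v • T.Estar v := by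
  have key : T.intMatrix.mulVec (x : V → ℚ)
      = T.intMatrix.mulVec ((∑ v, c v • T.Estar v : T.dualLattice) : V → ℚ) := by
    ext w
    rw [h, mulVec_sum_Estar]
  have := congrArg (T.intMatrix⁻¹.mulVec) key
  rw [Matrix.mulVec_mulVec, Matrix.mulVec_mulVec, Matrix.nonsing_inv_mul _ T.isUnit_det,
    Matrix.one_mulVec, Matrix.one_mulVec] at this
  exact Subtype.ext this

theorem intMatrix_mulVec (x : V → ℚ) (v : V) :
    T.intMatrix.mulVec x v = T.euler v * x v + ∑ y ∈ nbrs T.graph Finset.univ v, x y := by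
  rw [Matrix.mulVec, dotProduct, ← Finset.add_sum_erase _ _ (Finset.mem_univ v)]
  congr 1
  · simp [PlumbingGraph.intMatrix]
  · rw [nbrs, Finset.sum_filter, ← Finset.add_sum_erase _ _ (Finset.mem_univ v)]
    simp only [SimpleGraph.irrefl, if_false, zero_add]
    refine Finset.sum_congr rfl fun y hy => ?_
    simp [PlumbingGraph.intMatrix, (Finset.ne_of_mem_erase hy).symm]

/-- The element `∑_v n_v E_v` of `L ⊆ L'`. -/
def latticeVec (n : V → ℤ) : T.dualLattice :=
  ⟨fun v => n v, by
    rw [mem_dualLattice_iff]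
    intro v
    refine ⟨T.euler v * n v + ∑ y ∈ nbrs T.graph Finset.univ v, n y, ?_⟩
    rw [intMatrix_mulVec]
    push_cast
    rfl⟩

theorem cls_eq_iff (x y : T.dualLattice) : T.cls y = T.cls x ↔ ∃ n, y = x + T.latticeVec n := by
  rw [cls, cls, Submodule.Quotient.eq]
  constructor
  · intro h
    have h' : ∀ v, ∃ n : ℤ, ((y - x : T.dualLattice) : V → ℚ) v = n := h
    choose n hn using h'
    refine ⟨n, ?_⟩
    rw [← sub_eq_iff_eq_add']
    exact Subtype.ext (funext hn)
  · rintro ⟨n, rfl⟩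
    rw [add_sub_cancel_left]
    exact fun v => ⟨n v, rfl⟩

/-- The vertex weights attached to `∑_v a_v E_v^*`. -/
def vertexWeight (euler a : V → ℤ) (v : V) (s j : ℤ) : ℤ := baseWeight (j - (a v - euler v * s))

theorem diffOp_iterate_sub (φ : ℤ → ℤ) (c : ℤ) (d : ℕ) :
    ∀ j, diffOp^[d] (fun j => φ (j - c)) j = diffOp^[d] φ (j - c) := by
  induction d with
  | zero => simp
  | succ d ih =>
    intro j
    rw [iterate_succ_apply', iterate_succ_apply', diffOp, diffOp, ih, ih, sub_add_eq_add_sub]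

theorem z_add_latticeVec (a n : V → ℤ) :
    T.z (∑ v, a v • T.Estar v + T.latticeVec n)
      = weight T.graph Finset.univ (vertexWeight T.euler a) n := by
  rw [T.eq_sum_Estar (∑ v, a v • T.Estar v + T.latticeVec n)
    (fun v => a v - T.euler v * n v - ∑ y ∈ nbrs T.graph Finset.univ v, n y), z_sum_Estar, weight]
  · refine Finset.prod_congr rfl fun v _ => ?_
    rw [show vertexWeight T.euler a v (n v) = fun j => baseWeight (j - (a v - T.euler v * n v))
      from rfl, diffOp_iterate_sub]
    have : T.graph.degree v = (nbrs T.graph Finset.univ v).card := by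
      rw [← SimpleGraph.card_neighborFinset_eq_degree]
      congr 1
      ext x
      simp [mem_nbrs]
    rw [this, neg_sub]
  · intro v
    rw [Submodule.coe_add, Matrix.mulVec_add, Pi.add_apply, mulVec_sum_Estar, intMatrix_mulVec]
    simp only [latticeVec]
    push_cast
    ring

theorem QI_eq (I : Set V) (a : V → ℤ) :
    T.QI (T.cls (∑ v, a v • T.Estar v)) I (∑ v, a v • T.Estar v)
      = ∑ᶠ (n : V → ℤ) (_ : ∃ v ∈ I, n v < 0),
        weight T.graph Finset.univ (vertexWeight T.euler a) n := by
  set x := ∑ v, a v • T.Estar v with hx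
  have himage : {y : T.dualLattice | T.cls y = T.cls x ∧ ¬ ∀ v ∈ I, x.1 v ≤ y.1 v}
      = (fun n => x + T.latticeVec n) '' {n : V → ℤ | ∃ v ∈ I, n v < 0} := by
    have hlt : ∀ n : V → ℤ, (¬ ∀ v ∈ I, x.1 v ≤ (x + T.latticeVec n).1 v) ↔ ∃ v ∈ I, n v < 0 := by
      intro n
      simp [latticeVec]
    ext y
    simp only [Set.mem_ofPred_eq, cls_eq_iff, Set.mem_image]
    constructor
    · rintro ⟨⟨n, rfl⟩, h⟩
      exact ⟨n, (hlt n).1 h, rfl⟩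
    · rintro ⟨n, h, rfl⟩
      exact ⟨⟨n, rfl⟩, (hlt n).2 h⟩
  have hinj : Set.InjOn (fun n => x + T.latticeVec n) {n : V → ℤ | ∃ v ∈ I, n v < 0} := by
    intro n _ m _ h
    have h1 := congrArg Subtype.val (add_left_cancel h)
    funext v
    have h2 : (n v : ℚ) = m v := congrFun h1 v
    exact_mod_cast h2
  have h1 := finsum_mem_image (f := T.z) hinj
  rw [← himage] at h1
  simp only [z_add_latticeVec, hx] at h1
  exact h1

theorem Q_eq_QI_univ (h : T.H) (x : T.dualLattice) : T.Q h x = T.QI h Set.univ x := by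
  simp [Q, QI]

end Coefficients

/-! ### A positive vector from negative definiteness -/

section Positivity

variable {V : Type*} [Fintype V] (T : PlumbingTree V)

/-- Take $r=\sum_vE_v^*$, which pairs to $-1$ with every $E_v$. Its negative part $m$ must vanish:
where $m_v>0$ one has $(m+r)_v=0$, so non-negative off-diagonal entries give $(m,m+r)\ge 0$, hence
$(m,m)\ge\sum_vm_v\ge 0$. A zero coordinate of $r$ would make its pairing there non-negative. -/
theorem exists_dominant :
    ∃ r : V → ℚ, (∀ v, 0 < r v) ∧ Dominant T.graph Finset.univ r fun v => -(T.euler v : ℚ) := by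
  set r : V → ℚ := ((∑ v, (1 : ℤ) • T.Estar v : T.dualLattice) : V → ℚ) with hr
  have hM : ∀ v, T.intMatrix.mulVec r v = -1 := by
    intro v
    rw [hr, T.mulVec_sum_Estar (fun _ => 1)]
    simp
  have heuler : ∀ v, (T.euler v : ℚ) < 0 := by
    intro v
    have := T.negDef (Pi.single v 1) (by simp)
    rw [form_single, intMatrix_mulVec] at this
    rw [Finset.sum_eq_zero, add_zero, Pi.single_eq_same, mul_one] at this
    · exact this
    · intro y hy
      exact Pi.single_eq_of_ne (mem_nbrs.1 hy).2.ne' _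
  have hnonneg : ∀ v, 0 ≤ r v := by
    set m : V → ℚ := fun v => max (-r v) 0 with hm
    by_contra! hneg
    obtain ⟨v₀, hv₀⟩ := hneg
    have hm0 : m ≠ 0 := fun h => by
      have := congrFun h v₀
      simp only [hm, Pi.zero_apply] at this
      have h1 := le_max_left (-r v₀) 0
      linarith
    have h1 := T.negDef m hm0
    have hform : ∀ x y : V → ℚ, T.form x y = ∑ v, x v * T.intMatrix.mulVec y v := by
      intro x y
      simp [form_apply, Matrix.mulVec, dotProduct, Finset.mul_sum, mul_assoc]
    rw [hform] at h1
    have h2 : ∀ v, 0 ≤ m v * (T.intMatrix.mulVec m v + T.intMatrix.mulVec r v) := by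
      intro v
      rw [← Pi.add_apply, ← Matrix.mulVec_add, intMatrix_mulVec]
      have hm1 : 0 ≤ m v := le_max_right _ _
      have hs : ∀ y, 0 ≤ (m + r) y := fun y => by
        have := le_max_left (-r y) 0
        simp only [hm, Pi.add_apply]
        linarith
      rcases hm1.eq_or_lt with h | h
      · rw [← h, zero_mul]
      · have : (m + r) v = 0 := by
          simp only [hm, Pi.add_apply] at h ⊢
          rcases max_cases (-r v) 0 with h' | h' <;> linarith
        rw [this, mul_zero, zero_add]
        exact mul_nonneg hm1 (Finset.sum_nonneg fun y _ => hs y)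
    have h3 : ∑ v, m v * T.intMatrix.mulVec m v
        = ∑ v, m v * (T.intMatrix.mulVec m v + T.intMatrix.mulVec r v) + ∑ v, m v := by
      rw [← Finset.sum_add_distrib]
      refine Finset.sum_congr rfl fun v _ => ?_
      rw [hM]
      ring
    have h4 : 0 ≤ ∑ v, m v := Finset.sum_nonneg fun v _ => le_max_right _ _
    have h5 := Finset.sum_nonneg fun v (_ : v ∈ Finset.univ) => h2 v
    linarith
  refine ⟨r, fun v => ?_, fun v _ => ?_⟩
  · refine (hnonneg v).lt_of_ne fun h => ?_
    have h1 := hM v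
    rw [intMatrix_mulVec, ← h, mul_zero, zero_add] at h1
    have := Finset.sum_nonneg fun y (_ : y ∈ nbrs T.graph Finset.univ v) => hnonneg y
    linarith
  · have h1 := hM v
    rw [intMatrix_mulVec] at h1
    linarith

end Positivity

/-! ### Rooting a tree at a vertex -/

section Roots

variable {V : Type*} {G : SimpleGraph V}

/-- The path from the root `w` to `v`. -/
noncomputable def rootPath (hG : G.IsTree) (w v : V) : G.Walk w v :=
  (hG.existsUnique_path w v).choose

theorem rootPath_isPath (hG : G.IsTree) (w v : V) : (rootPath hG w v).IsPath :=
  (hG.existsUnique_path w v).choose_spec.1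

theorem eq_rootPath (hG : G.IsTree) {w v : V} {p : G.Walk w v} (hp : p.IsPath) :
    p = rootPath hG w v :=
  (hG.existsUnique_path w v).choose_spec.2 p hp

theorem rootPath_not_nil (hG : G.IsTree) {w v : V} (h : v ≠ w) : ¬ (rootPath hG w v).Nil :=
  fun hn => h hn.eq.symm

theorem penultimate_rootPath (hG : G.IsTree) {w u v : V} (h : G.Adj u v)
    (hu : u ∈ (rootPath hG w v).support) : v ≠ w ∧ u = (rootPath hG w v).penultimate := by
  have h1 := hG.isAcyclic.path_concat (rootPath_isPath hG w u) (rootPath_isPath hG w v) h hu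
  refine ⟨?_, ?_⟩
  · rintro rfl
    have h2 : SimpleGraph.Walk.nil = rootPath hG v v :=
      eq_rootPath hG SimpleGraph.Walk.IsPath.nil
    have h3 := congrArg SimpleGraph.Walk.length h1
    rw [← h2, SimpleGraph.Walk.length_concat, SimpleGraph.Walk.length_nil] at h3
    omega
  · rw [h1, SimpleGraph.Walk.penultimate_concat]

/-- The rooting of a tree at the vertex `w`. -/
noncomputable def treeRooting (hG : G.IsTree) (w : V) : Rooting G w where
  parent v := (rootPath hG w v).penultimate
  depth v := (rootPath hG w v).length
  adj_parent v hv := (SimpleGraph.Walk.adj_penultimate (rootPath_not_nil hG hv)).symm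
  depth_parent v hv := by
    have h := rootPath_not_nil hG hv
    rw [← eq_rootPath hG (rootPath_isPath hG w v).dropLast,
      ← SimpleGraph.Walk.length_dropLast_add_one h]
    exact Nat.lt_succ_self _
  eq_parent u v h := by
    by_cases hu : u ∈ (rootPath hG w v).support
    · exact Or.inl (penultimate_rootPath hG h hu)
    · exact Or.inr (penultimate_rootPath hG h.symm
        (hG.isAcyclic.mem_support_of_ne_mem_support_of_adj_of_isPath (rootPath_isPath hG w u)
          (rootPath_isPath hG w v) h hu))

/-- A path inside the connected set is also a path of the whole tree, hence by uniqueness the path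
to the root. -/
theorem treeRooting_closed (hG : G.IsTree) {w : V} {A : Finset V} {S : Set V}
    (hS : (G.induce S).Connected) (hAS : ∀ v, v ∈ A ↔ v ∈ S) (hw : w ∈ S) :
    (treeRooting hG w).Closed A := by
  refine ⟨(hAS w).2 hw, fun v hv _ => ?_⟩
  rw [hAS] at hv ⊢
  obtain ⟨p, hp⟩ := (hS.preconnected ⟨w, hw⟩ ⟨v, hv⟩).exists_isPath
  have h1 : p.map (SimpleGraph.Embedding.induce S).toHom = rootPath hG w v :=
    eq_rootPath hG (hp.map Subtype.val_injective)
  have h2 : (rootPath hG w v).penultimate ∈ (rootPath hG w v).support :=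
    SimpleGraph.Walk.getVert_mem_support _ _
  change (rootPath hG w v).penultimate ∈ S
  rw [← h1] at h2
  have h3 : _ ∈ (p.map (SimpleGraph.Embedding.induce S).toHom).support := h2
  rw [SimpleGraph.Walk.support_map, List.mem_map] at h3
  obtain ⟨x, _, hx⟩ := h3
  rw [← h1]
  refine Set.mem_of_eq_of_mem hx.symm ?_
  exact x.2

end Roots

/-! ### Sign constraints imposed through the weights -/

section Constrained

variable {V : Type*} {G : SimpleGraph V} {A : Finset V}

/-- The vertex weights `ψ`, constrained to configurations negative at `w` and non-negative
on `J`. -/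
noncomputable def constrained (ψ : V → ℤ → ℤ → ℤ) (J : Set V) (w v : V) (s j : ℤ) : ℤ :=
  if v = w ∧ 0 ≤ s ∨ v ∈ J ∧ s < 0 then 0 else ψ v s j

theorem weight_eq_zero {ψ : V → ℤ → ℤ → ℤ} {n : V → ℤ} {v : V} (hv : v ∈ A)
    (h : ψ v (n v) = 0) : weight G A ψ n = 0 := by
  refine Finset.prod_eq_zero hv ?_
  rw [h]
  exact diffOp_iterate_eq_zero (b := (∑ x ∈ nbrs G A v, n x) - 1) (fun _ _ => rfl) _ _ (by omega)

theorem weight_constrained (ψ : V → ℤ → ℤ → ℤ) (J : Set V) {w : V} (hw : w ∈ A) (n : V → ℤ) :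
    weight G A (constrained ψ J w) n
      = if n w < 0 ∧ ∀ v ∈ A, v ∈ J → 0 ≤ n v then weight G A ψ n else 0 := by
  split_ifs with h
  · refine Finset.prod_congr rfl fun v hv => ?_
    have h0 : constrained ψ J w v (n v) = ψ v (n v) := by
      refine funext fun j => if_neg ?_
      rintro (⟨rfl, h1⟩ | ⟨h1, h2⟩)
      · omega
      · have := h.2 v hv h1
        omega
    rw [h0]
  · by_cases h1 : n w < 0
    · have h2 : ∃ v ∈ A, v ∈ J ∧ n v < 0 := by
        by_contra! h2
        exact h ⟨h1, h2⟩
      obtain ⟨v, hv, hJ, hn⟩ := h2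
      exact weight_eq_zero hv (funext fun j => if_pos (Or.inr ⟨hJ, hn⟩))
    · exact weight_eq_zero hw (funext fun j => if_pos (Or.inl ⟨rfl, by omega⟩))

theorem supportedBelow_vertexWeight (euler a : V → ℤ) (v : V) :
    SupportedBelow (vertexWeight euler a v) (-(euler v : ℚ)) := by
  refine ⟨a v, fun s j h => ?_⟩
  have h1 : j - (a v - euler v * s) ≤ 0 := by
    by_contra! h1
    exact h (baseWeight_eq_zero h1)
  have h2 : ((j - (a v - euler v * s) : ℤ) : ℚ) ≤ 0 := by exact_mod_cast h1
  push_cast at h2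
  linarith

/-- `baseWeight` is linear of slope $-1$ up to $j=1$, so its difference is $1$ for $j\le 0$. The
lower bound on $a_v$ provides the margin $d$ here. -/
theorem diffOp_vertexWeight {euler a : V → ℤ} {v : V} {d : ℕ} (hd : (d : ℤ) ≤ a v) {s j : ℤ}
    (h : (j : ℚ) ≤ -(euler v : ℚ) * s + d) : diffOp (vertexWeight euler a v s) j = 1 := by
  have h1 : j ≤ -euler v * s + d := by exact_mod_cast h
  simp only [diffOp, vertexWeight, baseWeight]
  have h2 : j - (a v - euler v * s) ≤ 0 := by linarith
  omega

end Constrained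

/-! ### Sorting by the first negative vertex -/

section Surgery

variable {V : Type*} [Fintype V] (T : PlumbingTree V)

/-- The sum of the weights of the configurations on `A` that are negative somewhere on `I`. -/
noncomputable def negSum (A : Finset V) (I : Set V) (a : V → ℤ) : ℤ :=
  ∑ᶠ (n : SupportedOn A) (_ : ∃ v ∈ I, n.1 v < 0),
    weight T.graph A (vertexWeight T.euler a) n.1

theorem QI_eq_negSum (I : Set V) (a : V → ℤ) :
    T.QI (T.cls (∑ v, a v • T.Estar v)) I (∑ v, a v • T.Estar v)
      = T.negSum Finset.univ I a := by
  rw [QI_eq, negSum, ← finsum_comp_equiv (Equiv.subtypeUnivEquiv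
    (p := fun n : V → ℤ => ∀ v ∉ Finset.univ, n v = 0) (by simp))]
  rfl

variable {S : Set V} {A : Finset V}

/-- Extension by zero. -/
noncomputable def extendEquiv (hAS : ∀ v, v ∈ A ↔ v ∈ S) : SupportedOn A ≃ (S → ℤ) where
  toFun n v := n.1 v
  invFun m := ⟨fun v => if h : v ∈ S then m ⟨v, h⟩ else 0, fun v hv => by
    exact dif_neg fun h => hv ((hAS v).2 h)⟩
  left_inv n := by
    refine Subtype.ext (funext fun v => ?_)
    by_cases h : v ∈ S
    · simp [h]
    · simp [h, n.2 v fun h' => h ((hAS v).1 h')]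
  right_inv m := by
    funext v
    simp

theorem nbrs_induce_map (G : SimpleGraph V) (hAS : ∀ v, v ∈ A ↔ v ∈ S) (v : S) :
    (nbrs (G.induce S) Finset.univ v).map (Embedding.subtype _) = nbrs G A v := by
  ext x
  simp only [Finset.mem_map, mem_nbrs, Embedding.subtype_apply, hAS, Finset.mem_univ, true_and]
  constructor
  · rintro ⟨y, hy, rfl⟩
    exact ⟨y.2, hy⟩
  · rintro ⟨hx, h⟩
    exact ⟨⟨x, hx⟩, h, rfl⟩

theorem Q_restrict_eq_negSum (hS : (T.graph.induce S).Connected) (hAS : ∀ v, v ∈ A ↔ v ∈ S)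
    (a : V → ℤ) : (T.restrict S hS).Q
      ((T.restrict S hS).cls (∑ v : S, a v • (T.restrict S hS).Estar v))
      (∑ v : S, a v • (T.restrict S hS).Estar v) = T.negSum A Set.univ a := by
  rw [Q_eq_QI_univ, QI_eq (T.restrict S hS) Set.univ fun v : S => a v, negSum,
    ← finsum_comp_equiv (extendEquiv hAS)]
  refine finsum_congr fun n => ?_
  have h1 : (∃ v ∈ Set.univ, extendEquiv hAS n v < 0) ↔ ∃ v ∈ Set.univ, n.1 v < 0 := by
    constructor
    · rintro ⟨v, _, hv⟩
      exact ⟨v, trivial, hv⟩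
    · rintro ⟨v, _, hv⟩
      have hvS : v ∈ S := by
        by_contra h
        rw [n.2 v fun h' => h ((hAS v).1 h')] at hv
        exact lt_irrefl _ hv
      exact ⟨⟨v, hvS⟩, trivial, hv⟩
  rw [finsum_eq_if, finsum_eq_if]
  refine if_congr h1 ?_ rfl
  rw [weight, weight, Finset.prod_subtype A hAS]
  refine Finset.prod_congr rfl fun v _ => ?_
  rw [← nbrs_induce_map T.graph hAS, Finset.card_map, Finset.sum_map]
  rfl

/-- Away from $w$ the constraints only erase values at $s<0$, while stability concerns $s\ge 0$. The
margin required is a number of neighbours, at most $|\mathcal V|$. -/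
theorem admissible_constrained {w : V} {r : V → ℚ} (hr : ∀ v, 0 < r v)
    (hdom : Dominant T.graph Finset.univ r fun v => -(T.euler v : ℚ)) (J : Set V) {a : V → ℤ}
    (ha : ∀ v, (Fintype.card V : ℤ) ≤ a v) (hA : (treeRooting T.isTree w).Closed A) :
    Admissible (treeRooting T.isTree w) r A (constrained (vertexWeight T.euler a) J w)
      fun v => -(T.euler v : ℚ) where
  closed := hA
  dominant := hdom.mono hr (Finset.subset_univ A)
  supported v _ := by
    obtain ⟨K, hK⟩ := supportedBelow_vertexWeight T.euler a v
    refine ⟨K, fun s j h => hK s j fun h' => h ?_⟩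
    rw [constrained, h', ite_self]
  stable v _ hvw := by
    intro s j hs hj
    have h1 : constrained (vertexWeight T.euler a) J w v s = vertexWeight T.euler a v s :=
      funext fun j => if_neg (by rintro (⟨h, _⟩ | ⟨_, h⟩); exacts [hvw h, by omega])
    rw [h1]
    refine diffOp_vertexWeight (le_trans ?_ (ha v)) hj
    exact_mod_cast Finset.card_le_univ _
  root s hs := funext fun j => if_pos (Or.inl ⟨rfl, hs⟩)

/-- The vertices of `I` and those that precede `w` in a fixed linear order. -/
def precede (I : Set V) (w : V) : Set V := I ∪ {v | Fintype.equivFin V v < Fintype.equivFin V w}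

/-- If $n$ is non-negative on $I$ but negative somewhere, exactly one summand survives: that of its
first negative vertex. If $n$ is negative on $I$, every constrained summand vanishes. -/
theorem negSum_univ_pointwise (I : Set V) (ψ : V → ℤ → ℤ → ℤ) (n : SupportedOn A) :
    (if ∃ v, n.1 v < 0 then weight T.graph A ψ n.1 else 0)
      = (if ∃ v ∈ I, n.1 v < 0 then weight T.graph A ψ n.1 else 0)
        + ∑ w ∈ A with w ∉ I, weight T.graph A (constrained ψ (precede I w) w) n.1 := by
  have hmem : ∀ v, n.1 v < 0 → v ∈ A := fun v hv => by
    by_contra h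
    rw [n.2 v h] at hv
    exact lt_irrefl _ hv
  have hsum : ∑ w ∈ A with w ∉ I, weight T.graph A (constrained ψ (precede I w) w) n.1
      = ∑ w ∈ A with w ∉ I, if n.1 w < 0 ∧ ∀ v ∈ A, v ∈ precede I w → 0 ≤ n.1 v
        then weight T.graph A ψ n.1 else 0 :=
    Finset.sum_congr rfl fun w hw => by
      rw [weight_constrained ψ _ (Finset.mem_filter.1 hw).1 n.1]
      congr
  rw [hsum]
  by_cases hI : ∃ v ∈ I, n.1 v < 0
  · obtain ⟨v, hv, hn⟩ := hI
    rw [if_pos ⟨v, hn⟩, if_pos ⟨v, hv, hn⟩, Finset.sum_eq_zero, add_zero]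
    refine fun w _ => if_neg fun h => ?_
    have := h.2 v (hmem v hn) (Or.inl hv)
    omega
  · rw [if_neg hI, zero_add]
    push Not at hI
    split_ifs with hex
    · obtain ⟨v, hv⟩ := hex
      obtain ⟨w, hw, hmin⟩ := Finset.exists_min_image (Finset.univ.filter fun v => n.1 v < 0)
        (Fintype.equivFin V) ⟨v, by simpa using hv⟩
      simp only [Finset.mem_filter, Finset.mem_univ, true_and] at hw hmin
      rw [Finset.sum_eq_single w, if_pos]
      · refine ⟨hw, fun x _ hx => ?_⟩
        by_contra! hneg
        rcases hx with hx | hx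
        · exact absurd (hI x hx) (by omega)
        · exact absurd (hmin x hneg) (not_le.2 hx)
      · rintro x _ hxw
        refine if_neg fun h => hxw ?_
        apply (Fintype.equivFin V).injective
        refine le_antisymm ?_ (hmin x h.1)
        by_contra! hlt
        have := h.2 w (hmem w hw) (Or.inr hlt)
        omega
      · intro h
        exact absurd (Finset.mem_filter.2 ⟨hmem w hw, fun hwI => absurd (hI w hwI) (by omega)⟩) h
    · push Not at hex
      symm
      refine Finset.sum_eq_zero fun w _ => if_neg fun h => ?_
      have := hex w
      omega

theorem negSum_univ_eq {r : V → ℚ} (hr : ∀ v, 0 < r v)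
    (hdom : Dominant T.graph Finset.univ r fun v => -(T.euler v : ℚ)) (I : Set V) {a : V → ℤ}
    (ha : ∀ v, (Fintype.card V : ℤ) ≤ a v)
    (hA : ∀ w ∈ A, (treeRooting T.isTree w).Closed A) :
    T.negSum A Set.univ a = T.negSum A I a + ∑ w ∈ A with w ∉ I,
      stateSum T.graph A (constrained (vertexWeight T.euler a) (precede I w) w) := by
  set ψ := vertexWeight T.euler a
  have hfin : ∀ (J : Set V), ∀ w ∈ A,
      (support fun n : SupportedOn A => weight T.graph A (constrained ψ J w) n.1).Finite :=
    fun J w hw => (T.admissible_constrained hr hdom J ha (hA w hw)).finite_support hr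
  have hfinI : (support fun n : SupportedOn A =>
      if ∃ v ∈ I, n.1 v < 0 then weight T.graph A ψ n.1 else 0).Finite := by
    -- A configuration negative at $v$ keeps its weight under the sole constraint at $v$, so
    -- finitely many finite supports cover all of these.
    refine (A.finite_toSet.biUnion fun w hw => hfin ∅ w hw).subset fun n hn => ?_
    rw [mem_support, ne_eq, ite_eq_right_iff, not_forall] at hn
    obtain ⟨⟨v, _, hv⟩, hne⟩ := hn
    have hvA : v ∈ A := by
      by_contra h
      rw [n.2 v h] at hv
      exact lt_irrefl _ hv
    refine Set.mem_biUnion hvA ?_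
    rw [mem_support, weight_constrained ψ ∅ hvA, if_pos ⟨hv, by simp⟩]
    exact hne
  unfold negSum stateSum
  simp only [finsum_eq_if]
  rw [← finsum_sum_comm _ _ fun w hw => hfin _ w (Finset.mem_filter.1 hw).1,
    ← finsum_add_distrib hfinI]
  · refine finsum_congr fun n => ?_
    simpa using T.negSum_univ_pointwise I ψ n
  · refine ((A.filter (· ∉ I)).finite_toSet.biUnion
      fun w hw => hfin (precede I w) w (Finset.mem_filter.1 hw).1).subset fun n hn => ?_
    obtain ⟨w, hw, hne⟩ := Finset.exists_ne_zero_of_sum_ne_zero hn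
    exact Set.mem_biUnion (Finset.mem_coe.2 hw) hne

theorem jstar_sum_Estar (hS : (T.graph.induce S).Connected) (a : V → ℤ) :
    T.jstar S hS (∑ v, a v • T.Estar v) = ∑ v : S, a v • (T.restrict S hS).Estar v := by
  have h1 : ∀ v, T.jstar S hS (T.Estar v)
      = if h : v ∈ S then (T.restrict S hS).Estar ⟨v, h⟩ else 0 := by
    intro v
    rw [← show T.EstarBasis v = T.Estar v from Module.Basis.mk_apply _ _ v, jstar,
      Module.Basis.constr_basis]
  simp only [map_sum, map_zsmul, h1]
  rw [← Finset.sum_subset (Finset.subset_univ S.toFinset), Finset.sum_subtype S.toFinset (p := (· ∈ S)) (by simp)]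
  · refine Finset.sum_congr rfl fun v _ => ?_
    rw [dif_pos v.2]
  · intro v _ hv
    rw [dif_neg (by simpa using hv), smul_zero]

end Surgery

end PlumbingTree

/-! ### Assembling the surgery formula -/

open PlumbingTree in
theorem mainTheorem2 {V : Type*} [Fintype V] (T : PlumbingTree V) (I : Set V) (hI : I.Nonempty) :
    ∃ N : ℤ, ∀ a : V → ℤ, (∀ v, N ≤ a v) →
      ∀ l₀ : T.dualLattice, l₀ = ∑ v, a v • T.Estar v →
        T.Q (T.cls l₀) l₀ = T.QI (T.cls l₀) I l₀ +
          ∑ i : T.Comp I, (T.component I i).Q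
            ((T.component I i).cls (T.jstarComp I i l₀)) (T.jstarComp I i l₀) := by
  obtain ⟨r, hr, hdom⟩ := T.exists_dominant
  refine ⟨Fintype.card V, fun a ha l₀ hl₀ => ?_⟩
  subst hl₀
  have hclU : ∀ w ∈ Finset.univ, (treeRooting T.isTree w).Closed Finset.univ := fun w _ =>
    ⟨Finset.mem_univ _, fun _ _ _ => Finset.mem_univ _⟩
  rw [Q_eq_QI_univ, QI_eq_negSum, QI_eq_negSum, T.negSum_univ_eq hr hdom I ha hclU]
  congr 1
  have hdisj : ∀ (i : T.Comp I), ∀ v ∈ T.compVerts I i, v ∉ I := by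
    rintro i _ ⟨v, _, rfl⟩
    exact v.2
  have hcomp : ∀ i : T.Comp I, (T.component I i).Q
      ((T.component I i).cls (T.jstarComp I i (∑ v, a v • T.Estar v)))
      (T.jstarComp I i (∑ v, a v • T.Estar v))
      = ∑ w ∈ (T.compVerts I i).toFinset, stateSum T.graph Finset.univ
          (constrained (vertexWeight T.euler a) (precede I w) w) := by
    intro i
    have hS := T.compVerts_connected I i
    have hAS : ∀ v, v ∈ (T.compVerts I i).toFinset ↔ v ∈ T.compVerts I i := fun v =>
      Set.mem_toFinset
    have hcl : ∀ w ∈ (T.compVerts I i).toFinset,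
        (treeRooting T.isTree w).Closed (T.compVerts I i).toFinset := fun w hw =>
      treeRooting_closed T.isTree hS hAS ((hAS w).1 hw)
    have h1 : T.jstarComp I i (∑ v, a v • T.Estar v)
      = ∑ v : T.compVerts I i, a v • (T.restrict _ hS).Estar v := T.jstar_sum_Estar hS a
    rw [h1]
    refine (T.Q_restrict_eq_negSum hS hAS a).trans ?_
    rw [T.negSum_univ_eq hr hdom I ha hcl]
    have h0 : T.negSum (T.compVerts I i).toFinset I a = 0 := by
      refine finsum_eq_zero_of_forall_eq_zero fun n => ?_
      rw [finsum_eq_if, if_neg]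
      rintro ⟨v, hv, hn⟩
      rw [n.2 v fun h => hdisj i v ((hAS v).1 h) hv] at hn
      exact lt_irrefl _ hn
    rw [h0, zero_add, Finset.filter_true_of_mem fun v hv => hdisj i v ((hAS v).1 hv)]
    -- The order on the component is induced from $\mathcal V$, so both state sums carry the same
    -- constrained weights.
    refine Finset.sum_congr rfl fun w hw => Eq.symm ?_
    refine stateSum_eq_of_subset (treeRooting T.isTree w) hr _ _ _ _ _ _ _ rfl
      (Finset.subset_univ _) (T.admissible_constrained hr hdom _ ha (hclU w (Finset.mem_univ w)))
      (T.admissible_constrained hr hdom _ ha (hcl w hw)) (fun _ _ _ _ => rfl) ?_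
    rintro u _ hu ⟨v, hv, huv⟩ s hs
    refine funext fun j => if_pos (Or.inr ⟨Or.inl ?_, hs⟩)
    -- A neighbour of the component that avoids $I$ would belong to the same component.
    by_contra huI
    apply hu
    rw [hAS] at hv ⊢
    obtain ⟨v, hv, rfl⟩ := hv
    refine ⟨⟨u, huI⟩, ?_, rfl⟩
    rw [SimpleGraph.ConnectedComponent.mem_supp_iff] at hv ⊢
    rw [← hv, SimpleGraph.ConnectedComponent.eq]
    exact SimpleGraph.Adj.reachable huv
  rw [Finset.sum_congr rfl fun i _ => hcomp i, Finset.sum_sigma', eq_comm]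
  refine Finset.sum_bij (fun x _ => x.2) ?_ ?_ ?_ fun _ _ => rfl
  · rintro ⟨i, v⟩ h
    simp only [Finset.mem_sigma, Set.mem_toFinset, Finset.mem_univ, true_and] at h
    simpa using hdisj i v h
  · rintro ⟨i, v⟩ h ⟨i', v'⟩ h' (rfl : v = v')
    simp only [Finset.mem_sigma, Set.mem_toFinset, Finset.mem_univ, true_and] at h h'
    obtain ⟨x, hx, rfl⟩ := h
    obtain ⟨y, hy, hxy⟩ := h'
    obtain rfl := Subtype.ext hxy
    rw [SimpleGraph.ConnectedComponent.mem_supp_iff] at hx hy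
    rw [← hx, ← hy]
  · intro v hv
    have hv' : v ∉ I := by simpa using hv
    refine ⟨⟨(T.graph.induce Iᶜ).connectedComponentMk ⟨v, hv'⟩, v⟩, ?_, rfl⟩
    simp only [Finset.mem_sigma, Set.mem_toFinset, Finset.mem_univ, true_and]
    exact ⟨⟨v, hv'⟩, rfl, rfl⟩
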